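/- Let $N\ge 3$ be an integer and let $q\ne 1$ be a positive real number. All indices run over $1,\dots,N$, a repeated upper and lower index is summed over, $i'=N+1-i$, and a bracket such as $(i=j)$ or $(i<j)$ is $1$ if the condition holds and $0$ otherwise. Put $\varrho_i=\frac N2-i$ for $i<\frac{N+1}2$, $\varrho_i=0$ for $i=\frac{N+1}2$, $\varrho_i=\frac N2-i+1$ for $i>\frac{N+1}2$, and $$C^{ij}=C_{ij}=q^{-\varrho_i}(i=j'),\qquad K^{kl}_{ij}=C^{ij}C_{kl},$$ $$R^{kl}_{ij}=q^{(k=l)-(k=l')}(i=l)(j=k)+(q-q^{-1})(i<l)\bigl((i=k)(j=l)-K^{kl}_{ij}\bigr),$$ $$(R^{-})^{kl}_{ij}=R^{kl}_{ij}-(q-q^{-1})(k=i)(l=j)+(q-q^{-1})K^{kl}_{ij}.$$ The quantum Euclidean sphere $X=\mathrm{ES}_q^{N-1}$ is the unital complex algebra with generators $x_1,\dots,x_N$ and relations $$(R^-)^{kl}_{ij}x_kx_l=q^{-1}x_ix_j+\frac{q^{N-1}-q^{N-3}}{1+q^{N-2}}K^{kl}_{ij}x_kx_l,\qquad C^{kl}x_kx_l=1;$$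 it is a $*$-algebra with $x_i^*=C^{ij}x_j$. A first order differential calculus on $X$ is an $X$-bimodule $\Gamma$ with a linear map $d:X\to\Gamma$ such that $d(xy)=dx\cdot y+x\,dy$ and $\Gamma$ is the linear span of the elements $x\,dy$. It is a $*$-calculus if $\sum_k a_k\,db_k=0$ (a finite sum with $a_k,b_k\in X$) always implies $\sum_k d(b_k^*)\,a_k^*=0$. For each sign $\pm$ let $\Gamma_\pm$ be the first order differential calculus on $X$ that is generated by the differentials $dx_i$ with the bimodule structure $$dx_i\cdot x_j=\pm(R^-)^{kl}_{ij}x_k\,dx_l+(\pm q-1)x_i\,dx_j+\frac{q^N-q^{N-2}}{1\mp q^{N-1}}K^{kl}_{ij}x_k\,dx_l+\frac{(1\mp q)(1+q^{N-2})}{1\mp q^{N-1}}C^{kl}x_ix_jx_k\,dx_l ,$$ that is, the quotient of the universal first order differential calculus of $X$ by the sub-bimodule generated by these relations. Then $\Gamma_+$ and $\Gamma_-$ are $*$-calculi. Thus $(dx)^*:=d(x^*)$ is well defined: there is exactly one conjugate-linear involution $*$ of $\Gamma_\pm$ such that $(a\,\omega\,b)^*=b^*\omega^*a^*$ and $(da)^*=d(a^*)$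 for all $a,b\in X$, $\omega\in\Gamma_\pm$. The same conclusions hold for every first order differential calculus on $X$ which satisfies the above bimodule relations (for one of the two signs) and is free, i.e. whose one-forms $dx_1,\dots,dx_N$ are a basis of the left module of one-forms. -/

import Mathlib

open scoped TensorProduct

noncomputable section

namespace QSphere

/-! Structure constants of the quantum group `O_q(N)`. Indices run over `Fin N`, the
index `i : Fin N` standing for the number `i + 1 ∈ {1, …, N}`; the reflection
`i' = N + 1 - i` is `Fin.rev`. -/

/-- The constants `ϱ_i`. -/
def rho {N : ℕ} (i : Fin N) : ℝ :=
  if 2 * ((i : ℕ) + 1) < N + 1 then (N : ℝ) / 2 - ((i : ℕ) + 1)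
  else if 2 * ((i : ℕ) + 1) = N + 1 then 0
  else (N : ℝ) / 2 - ((i : ℕ) + 1) + 1

/-- The matrix `C^{ij} = C_{ij} = q^{-ϱ_i} (i = j')`. -/
def C {N : ℕ} (q : ℝ) (i j : Fin N) : ℝ :=
  if i = j.rev then q ^ (-rho i) else 0

/-- `K q k l i j` is `K^{kl}_{ij} = C^{ij} C_{kl}`. -/
def K {N : ℕ} (q : ℝ) (k l i j : Fin N) : ℝ := C q i j * C q k l

/-- `R q k l i j` is the entry `R^{kl}_{ij}` of the R-matrix of `O_q(N)`. -/
def R {N : ℕ} (q : ℝ) (k l i j : Fin N) : ℝ :=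
  (if i = l ∧ j = k then
    q ^ ((if k = l then (1 : ℤ) else 0) - (if k = l.rev then (1 : ℤ) else 0)) else 0)
  + (q - q⁻¹) * (if i < l then (if i = k ∧ j = l then (1 : ℝ) else 0) - K q k l i j else 0)

/-- `Rinv q k l i j` is the entry `(R⁻)^{kl}_{ij}` of the inverse
`R⁻ = R - (q - q⁻¹) I + (q - q⁻¹) K` of the R-matrix. -/
def Rinv {N : ℕ} (q : ℝ) (k l i j : Fin N) : ℝ :=
  R q k l i j - (q - q⁻¹) * (if k = i ∧ l = j then (1 : ℝ) else 0) + (q - q⁻¹) * K q k l i j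

/-- The coefficient of `K` in the commutation relations of the quantum Euclidean sphere. -/
def relCoeff (N : ℕ) (q : ℝ) : ℝ :=
  (q ^ ((N : ℤ) - 1) - q ^ ((N : ℤ) - 3)) / (1 + q ^ ((N : ℤ) - 2))

/-! The quantum Euclidean sphere `ES_q^{N-1}`. -/

/-- The defining relations of the quantum Euclidean sphere. -/
inductive Rel (N : ℕ) (q : ℝ) : FreeAlgebra ℂ (Fin N) → FreeAlgebra ℂ (Fin N) → Prop
  | comm (i j : Fin N) : Rel N q
      (∑ k, ∑ l, ((Rinv q k l i j : ℝ) : ℂ) • (FreeAlgebra.ι ℂ k * FreeAlgebra.ι ℂ l))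
      (((q⁻¹ : ℝ) : ℂ) • (FreeAlgebra.ι ℂ i * FreeAlgebra.ι ℂ j) +
        ((relCoeff N q : ℝ) : ℂ) •
          ∑ k, ∑ l, ((K q k l i j : ℝ) : ℂ) • (FreeAlgebra.ι ℂ k * FreeAlgebra.ι ℂ l))
  | sphere : Rel N q
      (∑ k, ∑ l, ((C q k l : ℝ) : ℂ) • (FreeAlgebra.ι ℂ k * FreeAlgebra.ι ℂ l)) 1

/-- The coordinate algebra `X = ES_q^{N-1}` over `ℂ`. -/
def Sphere (N : ℕ) (q : ℝ) : Type := RingQuot (Rel N q)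

instance (N : ℕ) (q : ℝ) : Ring (Sphere N q) := inferInstanceAs (Ring (RingQuot (Rel N q)))

instance (N : ℕ) (q : ℝ) : Algebra ℂ (Sphere N q) :=
  inferInstanceAs (Algebra ℂ (RingQuot (Rel N q)))

/-- The quotient map from the free algebra. -/
def mk (N : ℕ) (q : ℝ) : FreeAlgebra ℂ (Fin N) →ₐ[ℂ] Sphere N q :=
  RingQuot.mkAlgHom ℂ (Rel N q)

/-- The generators `x_i` of the quantum Euclidean sphere. -/
def x {N : ℕ} (q : ℝ) (i : Fin N) : Sphere N q := mk N q (FreeAlgebra.ι ℂ i)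

theorem comm_rel {N : ℕ} (q : ℝ) (i j : Fin N) :
    ∑ k, ∑ l, ((Rinv q k l i j : ℝ) : ℂ) • (x q k * x q l) =
      ((q⁻¹ : ℝ) : ℂ) • (x q i * x q j) +
        ((relCoeff N q : ℝ) : ℂ) • ∑ k, ∑ l, ((K q k l i j : ℝ) : ℂ) • (x q k * x q l) := by
  have h : mk N q _ = mk N q _ := RingQuot.mkAlgHom_rel ℂ (Rel.comm (N := N) (q := q) i j)
  simp only [map_sum, map_smul, map_mul, map_add] at h
  exact h

theorem sphere_rel (N : ℕ) (q : ℝ) :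
    ∑ k : Fin N, ∑ l, ((C q k l : ℝ) : ℂ) • (x q k * x q l) = 1 := by
  have h : mk N q _ = mk N q _ := RingQuot.mkAlgHom_rel ℂ (Rel.sphere (N := N) (q := q))
  simp only [map_sum, map_smul, map_mul, map_one] at h
  exact h

/-! The `*`-structure `x_i^* = C^{ij} x_j`. It is the conjugate-linear antiautomorphism
induced by these values on the generators, i.e. an algebra homomorphism into the opposite
algebra with conjugate scalar multiplication. -/

/-- The opposite algebra with conjugate scalar multiplication. -/
def ConjOp (A : Type*) : Type _ := Aᵐᵒᵖ

instance (A : Type*) [Ring A] : Ring (ConjOp A) := inferInstanceAs (Ring Aᵐᵒᵖ)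

instance (A : Type*) [Ring A] [Algebra ℂ A] : Algebra ℂ (ConjOp A) :=
  RingHom.toAlgebra' (((algebraMap ℂ Aᵐᵒᵖ).comp (starRingEnd ℂ) : ℂ →+* Aᵐᵒᵖ))
    (fun c a => Algebra.commutes (A := Aᵐᵒᵖ) (starRingEnd ℂ c) a)

/-- The identity map to the conjugate opposite algebra, and back. -/
def toConjOp {A : Type*} [Ring A] : A ≃+ ConjOp A := MulOpposite.opAddEquiv

theorem toConjOp_mul {A : Type*} [Ring A] (a b : A) :
    toConjOp (a * b) = toConjOp b * toConjOp a := rfl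

theorem toConjOp_one {A : Type*} [Ring A] : toConjOp (1 : A) = 1 := rfl

theorem toConjOp_smul {A : Type*} [Ring A] [Algebra ℂ A] (c : ℂ) (a : A) :
    c • toConjOp a = toConjOp (starRingEnd ℂ c • a) := by
  rw [Algebra.smul_def, Algebra.smul_def, Algebra.commutes (starRingEnd ℂ c) a, toConjOp_mul]
  rfl

theorem rho_rev {N : ℕ} (i : Fin N) : rho i.rev = -rho i := by
  have hi := i.isLt
  have hr : ((i.rev : Fin N) : ℕ) + ((i : ℕ) + 1) = N := by
    rw [Fin.val_rev]; omega
  have hr' : (((i.rev : Fin N) : ℕ) : ℝ) = N - ((i : ℕ) + 1) := by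
    rw [eq_sub_iff_add_eq]; exact_mod_cast hr
  unfold rho
  rcases lt_trichotomy (2 * ((i : ℕ) + 1)) (N + 1) with h | h | h
  · rw [if_neg (by omega), if_neg (by omega), if_pos h, hr']; ring
  · rw [if_neg (by omega), if_pos (by omega), if_neg (by omega), if_pos h]; ring
  · rw [if_pos (by omega), if_neg (by omega), if_neg (by omega), hr']; ring

/-- The constants `q^{-ϱ_i}`. -/
def c {N : ℕ} (q : ℝ) (i : Fin N) : ℝ := q ^ (-rho i)

theorem c_rev_mul {N : ℕ} {q : ℝ} (hq : 0 < q) (i : Fin N) : c q i.rev * c q i = 1 := by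
  unfold c
  rw [← Real.rpow_add hq, rho_rev]; simp

theorem C_eq {N : ℕ} (q : ℝ) (i j : Fin N) : C q i j = if i = j.rev then c q i else 0 := rfl

theorem K_rev {N : ℕ} {q : ℝ} (hq : 0 < q) (k l i j : Fin N) :
    c q k * c q l * K q k l i j = c q i * c q j * K q l.rev k.rev j.rev i.rev := by
  unfold K
  simp only [C_eq, Fin.rev_rev]
  by_cases h1 : i = j.rev
  · by_cases h2 : k = l.rev
    · subst h1 h2
      have a := c_rev_mul hq l
      have b := c_rev_mul hq j
      simp only [if_true]
      rw [a, b]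
    · have : ¬ l.rev = k := fun h => h2 h.symm
      simp [h2, this]
  · have : ¬ j.rev = i := fun h => h1 h.symm
    simp [h1, this]

theorem I_rev {N : ℕ} (q : ℝ) (k l i j : Fin N) :
    c q k * c q l * (if k = i ∧ l = j then (1 : ℝ) else 0) =
      c q i * c q j * (if l.rev = j.rev ∧ k.rev = i.rev then (1 : ℝ) else 0) := by
  simp only [Fin.rev_inj]
  by_cases h : k = i ∧ l = j
  · obtain ⟨rfl, rfl⟩ := h; simp
  · rw [if_neg h, if_neg (fun h' => h ⟨h'.2, h'.1⟩)]; simp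

theorem R_rev {N : ℕ} {q : ℝ} (hq : 0 < q) (k l i j : Fin N) :
    c q k * c q l * R q k l i j = c q i * c q j * R q l.rev k.rev j.rev i.rev := by
  unfold R
  rw [mul_add, mul_add]
  congr 1
  · simp only [Fin.rev_inj, Fin.rev_rev]
    by_cases h : i = l ∧ j = k
    · obtain ⟨rfl, rfl⟩ := h
      have e : (i = j) = (j = i) := propext eq_comm
      have e' : (i.rev = j) = (j = i.rev) := propext eq_comm
      simp only [e, e', and_self, if_true]
      ring
    · rw [if_neg h, if_neg (fun h' => h ⟨h'.2, h'.1⟩)]; simp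
  · rw [mul_left_comm, mul_left_comm (c q i * c q j)]
    congr 1
    have hI := I_rev q k l i j
    have hK := K_rev hq k l i j
    have eI : (i = k ∧ j = l) = (k = i ∧ l = j) := by simp only [eq_comm]
    have eI' : (j.rev = l.rev ∧ i.rev = k.rev) = (l.rev = j.rev ∧ k.rev = i.rev) := by
      simp only [eq_comm]
    simp only [eI, eI']
    simp only [Fin.rev_lt_rev]
    by_cases h : (k = i ∧ l = j) ∨ (i = j.rev ∧ k = l.rev)
    · have hlt : (i < l) = (k < j) := by
        rcases h with ⟨rfl, rfl⟩ | ⟨rfl, rfl⟩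
        · rfl
        · exact propext ⟨fun h => by rw [← Fin.rev_lt_rev]; simpa using h,
            fun h => by rw [← Fin.rev_lt_rev]; simpa using h⟩
      simp only [hlt]
      by_cases h' : k < j
      · rw [if_pos h', if_pos h', mul_sub, mul_sub, hI, hK]
      · rw [if_neg h', if_neg h']; simp
    · push Not at h
      have z1 : (if k = i ∧ l = j then (1 : ℝ) else 0) = 0 := if_neg (fun h' => h.1 h'.1 h'.2)
      have z2 : K q k l i j = 0 := by
        unfold K; rw [C_eq, C_eq]
        by_cases h' : i = j.rev
        · rw [if_neg (h.2 h')]; simp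
        · rw [if_neg h']; simp
      have z3 : (if l.rev = j.rev ∧ k.rev = i.rev then (1 : ℝ) else 0) = 0 := by
        simp only [Fin.rev_inj]
        exact if_neg (fun h' => h.1 h'.2 h'.1)
      have z4 : K q l.rev k.rev j.rev i.rev = 0 := by
        unfold K; rw [C_eq, C_eq]; simp only [Fin.rev_rev]
        by_cases h' : i = j.rev
        · rw [if_neg (show ¬ l.rev = k from fun e => h.2 h' e.symm)]; simp
        · rw [if_neg (show ¬ j.rev = i from fun e => h' e.symm)]; simp
      rw [z1, z2, z3, z4]; simp

theorem Rinv_rev {N : ℕ} {q : ℝ} (hq : 0 < q) (k l i j : Fin N) :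
    c q k * c q l * Rinv q k l i j = c q i * c q j * Rinv q l.rev k.rev j.rev i.rev := by
  unfold Rinv
  linear_combination R_rev hq k l i j - (q - q⁻¹) * I_rev q k l i j +
    (q - q⁻¹) * K_rev hq k l i j

/-- The element `C^{ij} x_j`. -/
def xs {N : ℕ} (q : ℝ) (i : Fin N) : Sphere N q := ∑ j, ((C q i j : ℝ) : ℂ) • x q j

theorem xs_eq {N : ℕ} (q : ℝ) (i : Fin N) : xs q i = ((c q i : ℝ) : ℂ) • x q i.rev := by
  unfold xs
  rw [Finset.sum_eq_single i.rev]
  · rw [C_eq]; simp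
  · intro j _ h
    rw [C_eq, if_neg (fun e => h (by rw [e, Fin.rev_rev]))]; simp
  · simp

/-- Reflecting the summation indices in a quadratic expression. -/
theorem sum_rev {N : ℕ} {q : ℝ} (F : Fin N → Fin N → ℝ) (G : Fin N → Fin N → ℝ) (s : ℝ)
    (h : ∀ k l, c q k * c q l * F k l = s * G l.rev k.rev) :
    ∑ k, ∑ l, ((F k l : ℝ) : ℂ) • (xs q l * xs q k) =
      (s : ℂ) • ∑ k, ∑ l, ((G k l : ℝ) : ℂ) • (x q k * x q l) := by
  rw [Finset.sum_comm, Finset.smul_sum, ← Equiv.sum_comp Fin.revPerm]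
  refine Finset.sum_congr rfl fun l _ => ?_
  rw [Finset.smul_sum, ← Equiv.sum_comp Fin.revPerm]
  refine Finset.sum_congr rfl fun k _ => ?_
  have := h k.rev l.rev
  simp only [Fin.rev_rev] at this
  simp only [Fin.revPerm_apply, xs_eq, Fin.rev_rev, smul_mul_assoc, mul_smul_comm, smul_smul]
  congr 1
  rw [← Complex.ofReal_mul s, ← this]
  push_cast; ring

/-- The `*`-structure as a homomorphism from the free algebra. -/
def starFree (N : ℕ) (q : ℝ) : FreeAlgebra ℂ (Fin N) →ₐ[ℂ] ConjOp (Sphere N q) :=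
  FreeAlgebra.lift ℂ (fun i => toConjOp (xs q i))

theorem starFree_sum {N : ℕ} (q : ℝ) (F : Fin N → Fin N → ℝ) :
    starFree N q (∑ k, ∑ l, ((F k l : ℝ) : ℂ) • (FreeAlgebra.ι ℂ k * FreeAlgebra.ι ℂ l)) =
      toConjOp (∑ k, ∑ l, ((F k l : ℝ) : ℂ) • (xs q l * xs q k)) := by
  simp only [map_sum, map_smul, map_mul, starFree, FreeAlgebra.lift_ι_apply, ← toConjOp_mul,
    toConjOp_smul, Complex.conj_ofReal]

theorem starFree_rel {N : ℕ} {q : ℝ} (hq : 0 < q) {a b : FreeAlgebra ℂ (Fin N)}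
    (h : Rel N q a b) : starFree N q a = starFree N q b := by
  cases h with
  | comm i j =>
    rw [map_add, map_smul, map_smul, map_mul, starFree_sum, starFree_sum]
    simp only [starFree, FreeAlgebra.lift_ι_apply]
    rw [← toConjOp_mul, toConjOp_smul, toConjOp_smul, ← map_add, Complex.conj_ofReal,
      Complex.conj_ofReal]
    congr 1
    rw [sum_rev _ (fun k l => Rinv q k l j.rev i.rev) (c q i * c q j)
        (fun k l => Rinv_rev hq k l i j),
      sum_rev _ (fun k l => K q k l j.rev i.rev) (c q i * c q j)
        (fun k l => K_rev hq k l i j), comm_rel, xs_eq, xs_eq]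
    simp only [smul_add, smul_mul_assoc, mul_smul_comm, smul_smul]
    push_cast
    congr 2 <;> ring
  | sphere =>
    rw [starFree_sum, map_one, ← toConjOp_one]
    congr 1
    rw [sum_rev _ (fun k l => C q k l) 1, sphere_rel]
    · simp
    · intro k l
      rw [C_eq, C_eq]
      by_cases h : k = l.rev
      · subst h
        have := c_rev_mul hq l
        simp only [Fin.rev_rev, if_true]
        rw [this]
      · rw [if_neg h, if_neg (fun e => h (by rw [e, Fin.rev_rev]))]; simp

/-- The `*`-structure as a homomorphism to the conjugate opposite algebra. -/
def starHom (N : ℕ) (q : ℝ) [hq : Fact (0 < q)] : Sphere N q →ₐ[ℂ] ConjOp (Sphere N q) :=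
  RingQuot.liftAlgHom ℂ ⟨starFree N q, fun _ _ h => starFree_rel hq.out h⟩

theorem starHom_mk (N : ℕ) (q : ℝ) [Fact (0 < q)] (a : FreeAlgebra ℂ (Fin N)) :
    starHom N q (mk N q a) = starFree N q a :=
  RingQuot.liftAlgHom_mkAlgHom_apply ℂ _ _ _

instance (N : ℕ) (q : ℝ) [Fact (0 < q)] : Star (Sphere N q) :=
  ⟨fun a => toConjOp.symm (starHom N q a)⟩

theorem star_def {N : ℕ} {q : ℝ} [Fact (0 < q)] (a : Sphere N q) :
    star a = toConjOp.symm (starHom N q a) := rfl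

theorem star_mul_aux {N : ℕ} {q : ℝ} [Fact (0 < q)] (a b : Sphere N q) :
    star (a * b) = star b * star a := by
  rw [star_def, map_mul]; rfl

theorem star_add_aux {N : ℕ} {q : ℝ} [Fact (0 < q)] (a b : Sphere N q) :
    star (a + b) = star a + star b := by
  rw [star_def, map_add]; rfl

theorem star_smul_aux {N : ℕ} {q : ℝ} [Fact (0 < q)] (r : ℂ) (a : Sphere N q) :
    star (r • a) = starRingEnd ℂ r • star a := by
  apply toConjOp.injective
  rw [← toConjOp_smul, star_def, star_def, AddEquiv.apply_symm_apply,
    AddEquiv.apply_symm_apply, map_smul]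

theorem star_one_aux {N : ℕ} {q : ℝ} [Fact (0 < q)] : star (1 : Sphere N q) = 1 := by
  rw [star_def, map_one]; rfl

/-- `x_i^* = C^{ij} x_j`. -/
theorem star_x {N : ℕ} {q : ℝ} [Fact (0 < q)] (i : Fin N) :
    star (x q i) = ∑ j, ((C q i j : ℝ) : ℂ) • x q j := by
  rw [star_def, x, starHom_mk, starFree, FreeAlgebra.lift_ι_apply, AddEquiv.symm_apply_apply]
  rfl

theorem star_star_x {N : ℕ} {q : ℝ} [hq : Fact (0 < q)] (i : Fin N) :
    star (star (x q i)) = x q i := by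
  have h (i : Fin N) : star (x q i) = ((c q i : ℝ) : ℂ) • x q i.rev := by
    rw [star_x, ← xs_eq]; rfl
  rw [h, star_smul_aux, h, Fin.rev_rev, smul_smul, Complex.conj_ofReal, ← Complex.ofReal_mul,
    mul_comm, c_rev_mul hq.out]
  simp

instance (N : ℕ) (q : ℝ) [Fact (0 < q)] : StarRing (Sphere N q) where
  star_involutive a := by
    obtain ⟨a, rfl⟩ := RingQuot.mkAlgHom_surjective ℂ (Rel N q) a
    change star (star (mk N q a)) = mk N q a
    induction a using FreeAlgebra.induction with
    | grade0 r =>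
      rw [AlgHom.commutes, Algebra.algebraMap_eq_smul_one, star_smul_aux, star_smul_aux,
        star_one_aux, star_one_aux, Complex.conj_conj]
    | grade1 i => exact star_star_x i
    | mul a b ha hb => rw [map_mul, star_mul_aux, star_mul_aux, ha, hb]
    | add a b ha hb => rw [map_add, star_add_aux, star_add_aux, ha, hb]
  star_mul := star_mul_aux
  star_add := star_add_aux

instance (N : ℕ) (q : ℝ) [Fact (0 < q)] : StarModule ℂ (Sphere N q) := ⟨star_smul_aux⟩

/-! First order differential calculi. A bimodule over `A` is a left `A`-module and a left
`Aᵐᵒᵖ`-module with commuting actions; `ω a` is written `MulOpposite.op a • ω`. -/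

/-- A first order differential calculus `(Γ, d)` on a complex algebra `A`. -/
structure Calculus (A Γ : Type*) [Ring A] [Algebra ℂ A] [AddCommGroup Γ] [Module ℂ Γ]
    [Module A Γ] [Module Aᵐᵒᵖ Γ] [SMulCommClass A Aᵐᵒᵖ Γ] [IsScalarTower ℂ A Γ]
    [IsScalarTower ℂ Aᵐᵒᵖ Γ] where
  d : A →ₗ[ℂ] Γ
  leibniz : ∀ a b : A, d (a * b) = MulOpposite.op b • d a + a • d b
  span_range : Submodule.span A (Set.range d) = ⊤

section Predicates

variable {A Γ : Type*} [Ring A] [Algebra ℂ A] [StarRing A] [AddCommGroup Γ] [Module ℂ Γ]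
  [Module A Γ] [Module Aᵐᵒᵖ Γ] [SMulCommClass A Aᵐᵒᵖ Γ] [IsScalarTower ℂ A Γ]
  [IsScalarTower ℂ Aᵐᵒᵖ Γ]

/-- `(Γ, d)` is a `*`-calculus: whenever `∑ a_k d b_k = 0`, also `∑ d(b_k^*) a_k^* = 0`. -/
def Calculus.IsStarCalculus (D : Calculus A Γ) : Prop :=
  ∀ (n : ℕ) (a b : Fin n → A), ∑ k, a k • D.d (b k) = 0 →
    ∑ k, MulOpposite.op (star (a k)) • D.d (star (b k)) = 0

/-- `s` is an involution of the bimodule of one-forms which extends the involution of `A`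
and satisfies `(d a)^* = d (a^*)`. -/
structure Calculus.IsFormStar (D : Calculus A Γ) (s : Γ → Γ) : Prop where
  map_add : ∀ ω η, s (ω + η) = s ω + s η
  map_smul : ∀ (r : ℂ) (ω), s (r • ω) = starRingEnd ℂ r • s ω
  map_left : ∀ (a : A) (ω), s (a • ω) = MulOpposite.op (star a) • s ω
  map_right : ∀ (a : A) (ω), s (MulOpposite.op a • ω) = star a • s ω
  involutive : ∀ ω, s (s ω) = ω
  map_d : ∀ a : A, s (D.d a) = D.d (star a)

end Predicates

/-! The bimodule structure of `Γ₊` and `Γ₋`. The sign is `ε : ℤˣ`: `ε = 1` belongs to `Γ₊`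
and `ε = -1` to `Γ₋`. -/

/-- The coefficient `(q^N - q^{N-2}) / (1 ∓ q^{N-1})`. -/
def coeffK (N : ℕ) (q : ℝ) (ε : ℤˣ) : ℝ :=
  (q ^ (N : ℤ) - q ^ ((N : ℤ) - 2)) / (1 - ((ε : ℤ) : ℝ) * q ^ ((N : ℤ) - 1))

/-- The coefficient `(1 ∓ q)(1 + q^{N-2}) / (1 ∓ q^{N-1})`. -/
def coeffC (N : ℕ) (q : ℝ) (ε : ℤˣ) : ℝ :=
  (1 - ((ε : ℤ) : ℝ) * q) * (1 + q ^ ((N : ℤ) - 2)) /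
    (1 - ((ε : ℤ) : ℝ) * q ^ ((N : ℤ) - 1))

section Structure

variable {N : ℕ} {q : ℝ} {Γ : Type*} [AddCommGroup Γ] [Module ℂ Γ] [Module (Sphere N q) Γ]
  [Module (Sphere N q)ᵐᵒᵖ Γ]

/-- The left-module expression prescribed for `dx_i · x_j` in `Γ_ε`. -/
def prescribed (ε : ℤˣ) (d : Sphere N q → Γ) (i j : Fin N) : Γ :=
  (((ε : ℤ) : ℝ) : ℂ) • ∑ k, ∑ l, ((Rinv q k l i j : ℝ) : ℂ) • (x q k • d (x q l))
  + ((((ε : ℤ) : ℝ) * q - 1 : ℝ) : ℂ) • (x q i • d (x q j))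
  + ((coeffK N q ε : ℝ) : ℂ) • ∑ k, ∑ l, ((K q k l i j : ℝ) : ℂ) • (x q k • d (x q l))
  + ((coeffC N q ε : ℝ) : ℂ) •
      ∑ k, ∑ l, ((C q k l : ℝ) : ℂ) • ((x q i * x q j * x q k) • d (x q l))

variable [SMulCommClass (Sphere N q) (Sphere N q)ᵐᵒᵖ Γ] [IsScalarTower ℂ (Sphere N q) Γ]
  [IsScalarTower ℂ (Sphere N q)ᵐᵒᵖ Γ]

/-- The calculus has the bimodule structure of `Γ_ε`. -/
def HasStructure (ε : ℤˣ) (D : Calculus (Sphere N q) Γ) : Prop :=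
  ∀ i j : Fin N, MulOpposite.op (x q j) • D.d (x q i) = prescribed ε D.d i j

/-- The calculus is free: the one-forms `dx_1, …, dx_N` are a basis of the left module of
one-forms. -/
def IsFree (D : Calculus (Sphere N q) Γ) : Prop :=
  LinearIndependent (Sphere N q) (fun i : Fin N => D.d (x q i)) ∧
    Submodule.span (Sphere N q) (Set.range fun i : Fin N => D.d (x q i)) = ⊤

end Structure

/-! Construction of `Γ_ε`: the quotient of the universal first order differential calculus by
the sub-bimodule generated by the relations `dx_i · x_j = …`. Bimodules over `A` are modules
over `A ⊗ Aᵐᵒᵖ`, where `(a ⊗ op b) ω = a ω b`. -/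

/-- The enveloping algebra. -/
abbrev Env (A : Type*) [Ring A] [Algebra ℂ A] : Type _ := A ⊗[ℂ] Aᵐᵒᵖ

/-- A module over the enveloping algebra, regarded as an `A`-bimodule. -/
def Bim (A : Type*) [Ring A] [Algebra ℂ A] (M : Type*) [AddCommGroup M] [Module (Env A) M] :
    Type _ := M

section Bim

variable (A : Type*) [Ring A] [Algebra ℂ A] (M : Type*) [AddCommGroup M] [Module (Env A) M]

instance : AddCommGroup (Bim A M) := inferInstanceAs (AddCommGroup M)

instance : Module (Env A) (Bim A M) := inferInstanceAs (Module (Env A) M)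

instance : Module A (Bim A M) :=
  Module.compHom (Bim A M)
    (Algebra.TensorProduct.includeLeft : A →ₐ[ℂ] Env A).toRingHom

instance : Module Aᵐᵒᵖ (Bim A M) :=
  Module.compHom (Bim A M)
    (Algebra.TensorProduct.includeRight : Aᵐᵒᵖ →ₐ[ℂ] Env A).toRingHom

instance : Module ℂ (Bim A M) := Module.compHom (Bim A M) (algebraMap ℂ (Env A))

variable {A M}

theorem left_smul (a : A) (m : Bim A M) : a • m = (a ⊗ₜ[ℂ] (1 : Aᵐᵒᵖ) : Env A) • m := rfl

theorem right_smul (b : Aᵐᵒᵖ) (m : Bim A M) : b • m = ((1 : A) ⊗ₜ[ℂ] b : Env A) • m := rfl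

theorem scalar_smul (r : ℂ) (m : Bim A M) : r • m = algebraMap ℂ (Env A) r • m := rfl

instance : SMulCommClass A Aᵐᵒᵖ (Bim A M) := ⟨fun a b m => by
  simp [left_smul, right_smul, smul_smul]⟩

instance : IsScalarTower ℂ A (Bim A M) := ⟨fun r a m => by
  rw [left_smul, left_smul, scalar_smul, smul_smul, ← Algebra.smul_def, TensorProduct.smul_tmul']⟩

instance : IsScalarTower ℂ Aᵐᵒᵖ (Bim A M) := ⟨fun r b m => by
  rw [right_smul, right_smul, scalar_smul, smul_smul, ← Algebra.smul_def,
    TensorProduct.tmul_smul]⟩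

end Bim

section Universal

variable (A : Type*) [Ring A] [Algebra ℂ A]

/-- The universal differential `a ↦ 1 ⊗ a - a ⊗ 1`. -/
def duEnv : A →ₗ[ℂ] Env A :=
  (Algebra.TensorProduct.includeRight : Aᵐᵒᵖ →ₐ[ℂ] Env A).toLinearMap ∘ₗ
      (MulOpposite.opLinearEquiv ℂ : A ≃ₗ[ℂ] Aᵐᵒᵖ).toLinearMap
    - (Algebra.TensorProduct.includeLeft : A →ₐ[ℂ] Env A).toLinearMap

/-- The bimodule of universal one-forms, as a left ideal of the enveloping algebra. -/
def uForms : Submodule (Env A) (Env A) := Submodule.span (Env A) (Set.range (duEnv A))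

/-- The bimodule of universal one-forms. -/
abbrev UForms : Type _ := Bim A (uForms A)

/-- The universal differential. -/
def du (a : A) : UForms A := (⟨duEnv A a, Submodule.subset_span ⟨a, rfl⟩⟩ : uForms A)

variable {A}

theorem duEnv_apply (a : A) :
    duEnv A a = (1 : A) ⊗ₜ[ℂ] MulOpposite.op a - a ⊗ₜ[ℂ] (1 : Aᵐᵒᵖ) := rfl

/-- The quotient of the bimodule of universal one-forms by the sub-bimodule generated by a
set of relations. -/
abbrev QForms (S : Set (UForms A)) : Type _ :=
  Bim A (UForms A ⧸ Submodule.span (Env A) S)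

/-- The quotient map. -/
def qmk (S : Set (UForms A)) : UForms A →ₗ[Env A] QForms S :=
  Submodule.mkQ (Submodule.span (Env A) S)

theorem qmk_left (S : Set (UForms A)) (a : A) (ω : UForms A) : qmk S (a • ω) = a • qmk S ω :=
  (qmk S).map_smul _ _

theorem qmk_right (S : Set (UForms A)) (a : Aᵐᵒᵖ) (ω : UForms A) :
    qmk S (a • ω) = a • qmk S ω := (qmk S).map_smul _ _

theorem qmk_scalar (S : Set (UForms A)) (r : ℂ) (ω : UForms A) :
    qmk S (r • ω) = r • qmk S ω := (qmk S).map_smul _ _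

theorem du_add (a b : A) : du A (a + b) = du A a + du A b :=
  Subtype.ext (map_add (duEnv A) a b)

theorem du_smul (r : ℂ) (a : A) : du A (r • a) = r • du A a := by
  refine Subtype.ext ((map_smul (duEnv A) r a).trans ?_)
  exact Algebra.smul_def (A := Env A) r (duEnv A a)

theorem du_mul (a b : A) : du A (a * b) = MulOpposite.op b • du A a + a • du A b := by
  refine Subtype.ext ?_
  change duEnv A (a * b) = ((1 : A) ⊗ₜ[ℂ] MulOpposite.op b : Env A) * duEnv A a +
    (a ⊗ₜ[ℂ] (1 : Aᵐᵒᵖ) : Env A) * duEnv A b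
  simp only [duEnv_apply, mul_sub, Algebra.TensorProduct.tmul_mul_tmul, one_mul, mul_one,
    MulOpposite.op_mul]
  abel

theorem span_du : Submodule.span A (Set.range (du A)) = ⊤ := by
  rw [eq_top_iff]
  rintro ⟨ω, hω⟩ -
  refine Submodule.span_induction
    (p := fun ω hω => (show UForms A from ⟨ω, hω⟩) ∈ Submodule.span A (Set.range (du A)))
    ?_ ?_ ?_ ?_ hω
  · rintro _ ⟨a, rfl⟩
    exact Submodule.subset_span ⟨a, rfl⟩
  · exact Submodule.zero_mem _
  · intro ω η hω hη h1 h2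
    exact Submodule.add_mem _ h1 h2
  · intro e ω hω h
    change e • (show UForms A from ⟨ω, hω⟩) ∈ _
    generalize (show UForms A from ⟨ω, hω⟩) = η at h
    clear hω ω
    have hr : ∀ b : Aᵐᵒᵖ, b • η ∈ Submodule.span A (Set.range (du A)) := by
      intro b
      induction h using Submodule.span_induction with
      | mem η hη =>
        obtain ⟨a, rfl⟩ := hη
        have : b • du A a = du A (a * b.unop) - a • du A b.unop := by
          rw [du_mul, MulOpposite.op_unop]; abel
        rw [this]
        exact Submodule.sub_mem _ (Submodule.subset_span ⟨_, rfl⟩)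
          (Submodule.smul_mem _ _ (Submodule.subset_span ⟨_, rfl⟩))
      | zero => rw [smul_zero]; exact Submodule.zero_mem _
      | add η θ _ _ h1 h2 => rw [smul_add]; exact Submodule.add_mem _ h1 h2
      | smul a η _ h1 => rw [← smul_comm]; exact Submodule.smul_mem _ _ h1
    induction e using TensorProduct.induction_on with
    | zero => rw [zero_smul (Env A) η]; exact Submodule.zero_mem _
    | add e f h1 h2 => rw [add_smul]; exact Submodule.add_mem _ h1 h2
    | tmul a b =>
      have : (a ⊗ₜ[ℂ] b : Env A) • η = a • (b • η) := by
        rw [left_smul, right_smul, smul_smul]; simp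
      rw [this]
      exact Submodule.smul_mem _ _ (hr b)

/-- The quotient of the universal calculus by a set of relations. -/
def quotCalculus (S : Set (UForms A)) : Calculus A (QForms S) where
  d :=
    { toFun := fun a => qmk S (du A a)
      map_add' := fun a b => by rw [du_add, map_add]
      map_smul' := fun r a => by rw [du_smul, qmk_scalar]; rfl }
  leibniz a b := by
    change qmk S (du A (a * b)) = MulOpposite.op b • qmk S (du A a) + a • qmk S (du A b)
    rw [du_mul, map_add, qmk_left, qmk_right]
  span_range := by
    rw [eq_top_iff]
    rintro ω -
    obtain ⟨ω, rfl⟩ := Submodule.mkQ_surjective (Submodule.span (Env A) S) ω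
    have h : ω ∈ Submodule.span A (Set.range (du A)) := by rw [span_du]; trivial
    change qmk S ω ∈ _
    induction h using Submodule.span_induction with
    | mem η hη =>
      obtain ⟨a, rfl⟩ := hη
      exact Submodule.subset_span ⟨a, rfl⟩
    | zero => rw [map_zero]; exact Submodule.zero_mem _
    | add η θ _ _ h1 h2 => rw [map_add]; exact Submodule.add_mem _ h1 h2
    | smul a η _ h1 => rw [qmk_left]; exact Submodule.smul_mem _ _ h1

end Universal

/-- The relations `dx_i · x_j = …` of `Γ_ε` among the universal one-forms. -/
def relations (N : ℕ) (q : ℝ) (ε : ℤˣ) : Set (UForms (Sphere N q)) :=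
  Set.range fun p : Fin N × Fin N =>
    MulOpposite.op (x q p.2) • du (Sphere N q) (x q p.1) -
      prescribed ε (du (Sphere N q)) p.1 p.2

/-- The bimodule of one-forms of `Γ_ε`. -/
abbrev Forms (N : ℕ) (q : ℝ) (ε : ℤˣ) : Type := QForms (relations N q ε)

/-- The calculus `Γ_ε` on `ES_q^{N-1}`. -/
def calculus (N : ℕ) (q : ℝ) (ε : ℤˣ) : Calculus (Sphere N q) (Forms N q ε) :=
  quotCalculus (relations N q ε)

/-- The constructed calculus has the prescribed bimodule structure. -/
theorem calculus_hasStructure (N : ℕ) (q : ℝ) (ε : ℤˣ) : HasStructure ε (calculus N q ε) := by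
  intro i j
  have h : qmk (relations N q ε) (MulOpposite.op (x q j) • du (Sphere N q) (x q i) -
      prescribed ε (du (Sphere N q)) i j) = 0 :=
    (Submodule.Quotient.mk_eq_zero _).2 (Submodule.subset_span ⟨(i, j), rfl⟩)
  rw [map_sub, sub_eq_zero, qmk_right] at h
  refine h.trans ?_
  simp only [prescribed, map_add, qmk_scalar, map_sum, qmk_left]
  rfl

end QSphere

end

noncomputable section

namespace QSphere

/-! Applying the involution formally to the bimodule relations of `Γ_ε` turns `dx_i · x_j = …` into
relations that express `x_i dx_j` through the right multiples `dx_k · x_l`. The theorem amounts to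
the fact that these dual relations (`dual_relation`) already follow from the original ones. The
symmetry of the structure constants under reflection of indices, `Rinv_rev` and `K_rev`, identifies
the two sets of formulas (`map_prescribed`).

For the dual relations, put `θ = C^{kl} x_k dx_l`. Differentiating the sphere relation gives `C^{kl}
dx_k · x_l = -θ`. Substituting the bimodule relations into the right-hand side leaves a combination
of `R⁻(x dx)_{ij}`, `x_i dx_j`, `C^{ij} θ` and `x_i x_j θ`. Three facts about the R-matrix are
needed: `R⁻ C = q^{N-1} C` (`sum_Rinv_mul_C`), the quadratic relation for `R⁻`
(`sum_Rinv_mul_Rinv`), and the crossing identity that turns `R⁻` into `R` (`c_mul_Rinv`). Crossing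
yields `θ x_m = x_m θ + γ dx_m` (`op_x_smul_theta`), which moves `x_i x_j` from the right of `θ` to
the left. The four coefficients then match by the scalar identities `coeffC_mul_coeffComm` and
`coeff_relation`.

The involution itself is built in two ways. The universal forms carry one, and for `Γ_ε` it
preserves the sub-bimodule of relations, so it descends. In a free calculus it is defined on left
coefficients with respect to `dx_1, …, dx_N`, and the dual relations give compatibility with right
multiplication. In both cases `Calculus.isStarCalculus_of_map` supplies the rest. -/

/-! ### Identities for the R-matrix -/

theorem c_pos {N : ℕ} {q : ℝ} (hq : 0 < q) (i : Fin N) : 0 < c q i := Real.rpow_pos_of_pos hq _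

theorem c_mul_rev {N : ℕ} {q : ℝ} (hq : 0 < q) (i : Fin N) : c q i * c q i.rev = 1 := by
  rw [mul_comm, c_rev_mul hq]

theorem c_of_rev_eq {N : ℕ} {q : ℝ} {i : Fin N} (h : i.rev = i) : c q i = 1 := by
  have := rho_rev i
  rw [h] at this
  have h0 : rho i = 0 := by linarith
  simp [c, h0]

/-- `ϱ_i` may be a half-integer, but `2ϱ_i` is always an integer, so the squares are integer powers
of `q`. -/
theorem c_rev_sq {N : ℕ} {q : ℝ} (hq : 0 < q) (i : Fin N) :
    c q i.rev ^ 2 = if i < i.rev then q ^ ((N : ℤ) - 2 * (i : ℕ) - 2)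
      else if i.rev = i then 1 else q ^ ((N : ℤ) - 2 * (i : ℕ)) := by
  have hi := i.isLt
  have key : ∀ z : ℤ, 2 * rho i = z → c q i.rev ^ 2 = q ^ z := by
    intro z hz
    rw [c, rho_rev, neg_neg, sq, ← Real.rpow_add hq, ← two_mul, hz, Real.rpow_intCast]
  have e1 : (i < i.rev) = (2 * ((i : ℕ) + 1) < N + 1) := by
    rw [Fin.lt_def, Fin.val_rev]; apply propext; omega
  have e2 : (i.rev = i) = (2 * ((i : ℕ) + 1) = N + 1) := by
    rw [Fin.ext_iff, Fin.val_rev]; apply propext; omega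
  simp only [e1, e2]
  split_ifs with h1 h2
  · apply key; rw [rho, if_pos h1]; push_cast; ring
  · rw [key 0, zpow_zero]; rw [rho, if_neg h1, if_pos h2]; simp
  · apply key; rw [rho, if_neg h1, if_neg h2]; push_cast; ring

/-- A geometric sum with ratio `q^{-2}`, which telescopes; the two bracket terms correct for the
irregular step of `ϱ` at the middle of the index range. -/
theorem sum_c_rev_sq {N : ℕ} {q : ℝ} (hq : 0 < q) (i : Fin N) :
    (q - q⁻¹) * ∑ l ∈ Finset.Iic i, c q l.rev ^ 2 =
      q ^ ((N : ℤ) - 1) - q⁻¹ * c q i.rev ^ 2 + (if i.rev < i then q - q⁻¹ else 0)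
        + (if i.rev = i then q - 1 else 0) := by
  have hq0 : q ≠ 0 := hq.ne'
  obtain ⟨n, hn⟩ := i
  induction n with
  | zero =>
    have : Finset.Iic (⟨0, hn⟩ : Fin N) = {⟨0, hn⟩} := by
      ext l; simp [Fin.le_def, Fin.ext_iff]
    rw [this, Finset.sum_singleton, c_rev_sq hq]
    simp only [Fin.lt_def, Fin.ext_iff, Fin.val_rev]
    rcases (show N = 1 ∨ 1 < N by omega) with h | h
    · subst h; simp
    · rw [if_pos (by omega), if_neg (by omega), if_neg (by omega)]
      simp only [zpow_sub₀ hq0]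
      simp
      field_simp
  | succ n ih =>
    have hn' : n < N := by omega
    have : Finset.Iic (⟨n + 1, hn⟩ : Fin N) = insert ⟨n + 1, hn⟩ (Finset.Iic ⟨n, hn'⟩) := by
      ext l; simp only [Finset.mem_Iic, Finset.mem_insert, Fin.le_def, Fin.ext_iff]; omega
    rw [this, Finset.sum_insert (by simp [Fin.le_def]), mul_add, ih hn', c_rev_sq hq, c_rev_sq hq]
    simp only [Fin.lt_def, Fin.ext_iff, Fin.val_rev]
    -- The cases: both indices in the first half, `n + 1` the middle, `n` and `n + 1` the two
    -- central indices, `n` the middle, both in the second half.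
    rcases (show 2 * n + 4 < N + 1 ∨ N = 2 * n + 3 ∨ N = 2 * n + 2 ∨ N = 2 * n + 1 ∨
      N + 1 < 2 * n + 2 by omega) with h | h | h | h | h
    · rw [if_pos (by omega), if_pos (by omega), if_neg (by omega), if_neg (by omega),
        if_neg (by omega), if_neg (by omega)]
      push_cast
      simp only [mul_add, zpow_sub₀ hq0, zpow_add₀ hq0]
      simp
      field_simp
      ring
    · rw [if_neg (by omega), if_pos (by omega), if_pos (by omega), if_neg (by omega),
        if_neg (by omega), if_neg (by omega), if_pos (by omega), h]
      push_cast
      have : ((2 : ℤ) * n + 3 - 2 * n - 2) = 1 := by ring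
      rw [this, zpow_one]
      field_simp
      ring
    · rw [if_neg (by omega), if_neg (by omega), if_pos (by omega), if_neg (by omega),
        if_neg (by omega), if_pos (by omega), if_neg (by omega), h]
      push_cast
      have e1 : ((2 : ℤ) * n + 2 - 2 * n - 2) = 0 := by ring
      have e2 : ((2 : ℤ) * n + 2 - 2 * (n + 1)) = 0 := by ring
      rw [e1, e2, zpow_zero]
      ring
    · rw [if_neg (by omega), if_neg (by omega), if_neg (by omega), if_pos (by omega),
        if_neg (by omega), if_pos (by omega), if_pos (by omega), if_neg (by omega), h]
      push_cast
      have e2 : ((2 : ℤ) * n + 1 - 2 * (n + 1)) = -1 := by ring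
      rw [e2, zpow_neg_one]
      field_simp
      ring
    · rw [if_neg (by omega), if_neg (by omega), if_neg (by omega), if_neg (by omega),
        if_pos (by omega), if_neg (by omega), if_pos (by omega), if_neg (by omega)]
      push_cast
      simp only [mul_add, zpow_sub₀ hq0, zpow_add₀ hq0]
      simp
      field_simp
      ring

/-- The full terms `I` and `K` in `R⁻` complement the bracket `(i < l)` in `R` to `(l ≤ i)` with the
opposite sign. -/
theorem Rinv_eq {N : ℕ} (q : ℝ) (k l i j : Fin N) :
    Rinv q k l i j = (if i = l then if j = k then
        q ^ ((if i = j then (1 : ℤ) else 0) - (if i = j.rev then (1 : ℤ) else 0)) else 0 else 0)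
      - (q - q⁻¹) * (if k = i then if l = j then if j ≤ i then 1 else 0 else 0 else 0)
      + (q - q⁻¹) * (if l ≤ i then K q k l i j else 0) := by
  unfold Rinv R
  have e1 : (if i = l ∧ j = k then
      q ^ ((if k = l then (1 : ℤ) else 0) - (if k = l.rev then (1 : ℤ) else 0)) else 0) =
      (if i = l then if j = k then
        q ^ ((if i = j then (1 : ℤ) else 0) - (if i = j.rev then (1 : ℤ) else 0)) else 0 else 0) := by
    by_cases h : i = l
    · by_cases h' : j = k
      · subst h h'
        have a1 : (j = i) = (i = j) := propext eq_comm
        have a2 : (j = i.rev) = (i = j.rev) := by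
          apply propext; constructor <;> (intro h; rw [h, Fin.rev_rev])
        simp [a1, a2]
      · simp [h']
    · simp [h]
  rw [e1]
  have a1 : (i = k ∧ j = l) = (k = i ∧ l = j) := by simp only [eq_comm]
  simp only [a1]
  by_cases h : i < l
  · have h' : ¬ l ≤ i := not_le.2 h
    by_cases hk : k = i ∧ l = j
    · obtain ⟨rfl, rfl⟩ := hk; simp [h, h']; ring
    · have : (if k = i then if l = j then if j ≤ i then (1 : ℝ) else 0 else 0 else 0) = 0 := by
        split_ifs with b1 b2 <;> first | rfl | exact absurd ⟨b1, b2⟩ hk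
      simp [h, h', hk, this]
  · have h' : l ≤ i := not_lt.1 h
    by_cases hk : k = i ∧ l = j
    · obtain ⟨rfl, rfl⟩ := hk; simp [h, h']
    · have : (if k = i then if l = j then if j ≤ i then (1 : ℝ) else 0 else 0 else 0) = 0 := by
        split_ifs with b1 b2 <;> first | rfl | exact absurd ⟨b1, b2⟩ hk
      simp [h, h', hk, this]

theorem sum_C_mul {N : ℕ} (q : ℝ) (G : Fin N → Fin N → ℝ) :
    ∑ k, ∑ l, C q k l * G k l = ∑ l, c q l.rev * G l.rev l := by
  rw [Finset.sum_comm]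
  simp [C_eq]

theorem sum_Rinv_mul {N : ℕ} (q : ℝ) (i j : Fin N) (G : Fin N → Fin N → ℝ) :
    ∑ k, ∑ l, Rinv q k l i j * G k l =
      q ^ ((if i = j then (1 : ℤ) else 0) - (if i = j.rev then (1 : ℤ) else 0)) * G j i
      - (q - q⁻¹) * (if j ≤ i then G i j else 0)
      + (q - q⁻¹) * C q i j * ∑ l ∈ Finset.Iic i, c q l.rev * G l.rev l := by
  have e : ∑ l ∈ Finset.Iic i, c q l.rev * G l.rev l =
      ∑ k, ∑ l, C q k l * (if l ≤ i then G k l else 0) := by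
    rw [sum_C_mul, show Finset.Iic i = Finset.univ.filter (fun l => l ≤ i) by ext; simp,
      Finset.sum_filter]
    refine Finset.sum_congr rfl fun l _ => ?_
    split_ifs <;> simp
  rw [e]
  simp only [Rinv_eq, K]
  generalize q - q⁻¹ = t
  simp only [add_mul, sub_mul, Finset.sum_add_distrib, Finset.sum_sub_distrib]
  congr 1
  · congr 1
    · simp
    · simp
  · simp only [Finset.mul_sum, mul_assoc]
    refine Finset.sum_congr rfl fun k _ => Finset.sum_congr rfl fun l _ => ?_
    split_ifs <;> ring

theorem c_rev_eq_inv {N : ℕ} {q : ℝ} (hq : 0 < q) (i : Fin N) : c q i.rev = (c q i)⁻¹ :=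
  eq_inv_of_mul_eq_one_left (c_rev_mul hq i)

theorem sum_Rinv_mul_C {N : ℕ} {q : ℝ} (hq : 0 < q) (i j : Fin N) :
    ∑ k, ∑ l, Rinv q k l i j * C q k l = q ^ ((N : ℤ) - 1) * C q i j := by
  rw [sum_Rinv_mul]
  have e : ∑ l ∈ Finset.Iic i, c q l.rev * C q l.rev l = ∑ l ∈ Finset.Iic i, c q l.rev ^ 2 :=
    Finset.sum_congr rfl fun l _ => by simp [C_eq, sq]
  have hV := sum_c_rev_sq hq i
  rw [e, mul_right_comm, hV]
  generalize q ^ ((N : ℤ) - 1) = Y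
  simp only [C_eq]
  by_cases h : i = j.rev
  · obtain rfl : j = i.rev := by rw [h, Fin.rev_rev]
    have hc := c_pos hq i
    rcases lt_trichotomy i i.rev with h1 | h1 | h1
    · simp [h1.ne, h1.ne', h1.not_gt, h1.not_ge, c_rev_eq_inv hq]
      field_simp
      ring
    · simp [← h1, c_of_rev_eq h1.symm]
      ring
    · simp [h1.ne, h1.ne', h1, h1.le, c_rev_eq_inv hq]
      field_simp
      ring
  · have h' : ¬ j = i.rev := fun e => h (by rw [e, Fin.rev_rev])
    simp [h, h']

/-- This truncated contraction of `R⁻` with `C` arises when the `K`-part of one factor `R⁻` meets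
the second factor. Once `m ≤ i` the truncation is invisible and the full value `q^{N-1} c_m`
appears. -/
theorem sum_c_mul_Rinv {N : ℕ} {q : ℝ} (hq : 0 < q) (i m : Fin N) :
    ∑ l ∈ Finset.Iic i, c q l.rev * Rinv q m m.rev l.rev l =
      c q m * (q ^ ((N : ℤ) - 1) + if i < m then (- q⁻¹ * c q i.rev ^ 2
        + (if i.rev < i then q - q⁻¹ else 0) + (if i.rev = i then q - 1 else 0)
        - (if i.rev ≤ m then q - q⁻¹ else 0)) else 0) := by
  have e : ∀ l : Fin N, c q l.rev * Rinv q m m.rev l.rev l =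
      (if l = m then c q m.rev * q ^ ((if m.rev = m then (1 : ℤ) else 0) - 1) else 0)
      - (if l = m.rev then (q - q⁻¹) * (if m.rev ≤ m then c q m else 0) else 0)
      + (q - q⁻¹) * c q m * (if l ≤ m then c q l.rev ^ 2 else 0) := by
    intro l
    rw [Rinv_eq]
    by_cases h1 : l = m
    · subst h1
      by_cases h2 : l = l.rev
      · have h3 := c_of_rev_eq (q := q) h2.symm
        simp [← h2, h3, K, C_eq]
      · simp [h2, Ne.symm h2, K, C_eq]
        ring
    · by_cases h2 : l = m.rev
      · subst h2
        simp [h1, Ne.symm h1, K, C_eq]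
        split_ifs <;> ring
      · have h4 : ¬ m = l.rev := fun e => h2 (by rw [e, Fin.rev_rev])
        simp [h1, h2, h4, K, C_eq]
        split_ifs <;> ring
  simp only [e, Finset.sum_add_distrib, Finset.sum_sub_distrib, ← Finset.mul_sum,
    Finset.sum_ite_eq', Finset.mem_Iic]
  have e3 : ∑ l ∈ Finset.Iic i, (if l ≤ m then c q l.rev ^ 2 else 0) =
      ∑ l ∈ Finset.Iic (min i m), c q l.rev ^ 2 := by
    rw [← Finset.sum_filter]
    refine Finset.sum_congr (by ext; simp) fun _ _ => rfl
  rw [e3, mul_right_comm, sum_c_rev_sq hq]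
  generalize q ^ ((N : ℤ) - 1) = Y
  have hc := c_pos hq m
  have hq0 := hq.ne'
  rcases lt_or_ge i m with h | h
  · rw [min_eq_left h.le]
    have e4 : (m.rev ≤ i) = (i.rev ≤ m) := by
      apply propext; rw [← Fin.rev_le_rev, Fin.rev_rev]
    simp only [h, if_true, h.not_ge, if_false, e4]
    by_cases h5 : i.rev ≤ m
    · have : m.rev ≤ m := by rw [← e4] at h5; exact h5.trans h.le
      simp [h5, this]
      ring
    · simp [h5]
      ring
  · rw [min_eq_right h]
    simp only [h, if_true, h.not_gt, if_false]
    rcases lt_trichotomy m m.rev with h1 | h1 | h1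
    · simp [h1.ne', h1.not_gt, h1.not_ge, c_rev_eq_inv hq]
      field_simp
      ring
    · simp [← h1, c_of_rev_eq h1.symm, h]
      ring
    · simp [h1.ne, h1, h1.le, h1.le.trans h, c_rev_eq_inv hq]
      field_simp
      ring

theorem Rinv_eq_zero {N : ℕ} (q : ℝ) {k l i j : Fin N} (h1 : ¬ (k = i ∧ l = j))
    (h2 : ¬ (i = l ∧ j = k)) (h3 : ¬ (i = j.rev ∧ k = l.rev)) : Rinv q k l i j = 0 := by
  have hK : K q k l i j = 0 := by
    unfold K C
    split_ifs with b1 b2 <;> simp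
    exact absurd ⟨b1, b2⟩ h3
  have h1' : ¬ (i = k ∧ j = l) := fun e => h1 ⟨e.1.symm, e.2.symm⟩
  simp [Rinv, R, h1, h1', h2, hK]

theorem Rinv_of_ne_rev {N : ℕ} (q : ℝ) {k l i j : Fin N} (h : i ≠ j.rev) :
    Rinv q k l i j = (if i = l ∧ j = k then (if i = j then q else 1) else 0)
      - (q - q⁻¹) * (if k = i ∧ l = j then if j ≤ i then 1 else 0 else 0) := by
  have hK : K q k l i j = 0 := by simp [K, C_eq, h]
  rw [Rinv_eq, hK, ← ite_and, ← ite_and (k = i) (l = j)]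
  by_cases hij : i = j
  · subst hij; simp [h]
  · simp [h, hij]

/-- In view of `R⁻ K = q^{N-1} K`, this is `R⁻ R = I` with `R` written through `R⁻`. It is checked
entrywise. -/
theorem sum_Rinv_mul_Rinv {N : ℕ} {q : ℝ} (hq : 0 < q) (m n i j : Fin N) :
    ∑ k, ∑ l, Rinv q k l i j * Rinv q m n k l =
      (if m = i ∧ n = j then 1 else 0) - (q - q⁻¹) * Rinv q m n i j
        + (q - q⁻¹) * q ^ ((N : ℤ) - 1) * K q m n i j := by
  have hq0 := hq.ne'
  rw [sum_Rinv_mul]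
  -- Only for `i = j'` does `K` contribute; for the other pairs the matrix splits into blocks of
  -- size at most two.
  by_cases h : i = j.rev
  · obtain rfl : j = i.rev := by rw [h, Fin.rev_rev]
    by_cases hm : n = m.rev
    · subst hm
      rw [sum_c_mul_Rinv hq, Rinv_eq, Rinv_eq]
      generalize q ^ ((N : ℤ) - 1) = Y
      have hc := c_pos hq i
      have hc' := c_pos hq m
      by_cases hmi : m = i
      · subst hmi
        rcases lt_trichotomy m m.rev with h1 | h1 | h1
        · simp [h1.ne', h1.ne, h1.not_ge, K, C_eq, c_rev_eq_inv hq]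
          field_simp
          ring
        · simp [← h1, c_of_rev_eq h1.symm, K, C_eq]
        · simp [h1.ne, h1.ne', h1.le, K, C_eq, c_rev_eq_inv hq]
          field_simp
          ring
      · by_cases hmi' : m = i.rev
        · subst hmi'
          rcases lt_trichotomy i i.rev with h1 | h1 | h1
          · simp [h1.ne', h1.ne, h1, h1.le, h1.not_gt, h1.not_ge, K, C_eq, c_rev_eq_inv hq]
            field_simp
            ring
          · exact absurd h1.symm hmi
          · simp [h1.ne, h1.ne', h1.le, h1.not_gt, h1.not_ge, K, C_eq, c_rev_eq_inv hq]
            field_simp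
        · have hmi3 : ¬ i = m.rev := fun e => hmi' (by rw [e, Fin.rev_rev])
          have hmi5 : ¬ i = m := Ne.symm hmi
          have e4 : (m.rev ≤ i) = (i.rev ≤ m) := by
            apply propext; rw [← Fin.rev_le_rev, Fin.rev_rev]
          have e5 : (m.rev ≤ i.rev) = (i ≤ m) := by
            apply propext; rw [Fin.rev_le_rev]
          simp only [hmi, hmi', hmi3, hmi5, Ne.symm hmi', K, C_eq, c_rev_eq_inv hq, e4, e5,
            Fin.rev_rev, Fin.rev_inj, if_true, if_false, false_and]
          rcases lt_trichotomy i i.rev with h1 | h1 | h1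
          · rcases lt_or_gt_of_ne hmi5 with h2 | h2
            · by_cases h3 : i.rev ≤ m
              · simp [h1.ne', h1.ne, h1.not_gt, h1.not_ge, h2, h2.le, h3]
                field_simp
                ring
              · simp [h1.ne', h1.ne, h1.not_gt, h1.not_ge, h2, h2.le, h3]
                field_simp
                ring
            · have h3 : ¬ i.rev ≤ m := not_le.2 (h2.trans h1)
              simp [h1.ne, h1.not_ge, h2.not_gt, h2.not_ge, h3]
              field_simp
          · have hc1 := c_of_rev_eq (q := q) h1.symm
            rcases lt_or_gt_of_ne hmi5 with h2 | h2
            · simp [← h1, h2, h2.le, hc1]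
              field_simp
              ring
            · simp [← h1, h2.not_gt, h2.not_ge, hc1]
              field_simp
          · rcases lt_or_gt_of_ne hmi5 with h2 | h2
            · have h3 : i.rev ≤ m := (h1.trans h2).le
              simp [h1.ne', h1.ne, h1, h1.le, h2, h2.le, h3]
              field_simp
              ring
            · simp [h1.ne', h1.le, h2.not_gt, h2.not_ge]
              field_simp
    · have h3 : ¬ m = n.rev := fun e => hm (by rw [e, Fin.rev_rev])
      have e0 : ∀ a b : Fin N, a = b.rev → Rinv q m n a b = 0 := by
        rintro a b rfl
        refine Rinv_eq_zero q ?_ ?_ ?_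
        · rintro ⟨rfl, rfl⟩; exact h3 rfl
        · rintro ⟨rfl, rfl⟩; exact hm rfl
        · rintro ⟨-, e⟩; exact h3 e
      have h5 : ¬ (m = i ∧ n = i.rev) := by rintro ⟨rfl, rfl⟩; exact hm rfl
      simp [e0, h5, K, C_eq, h3]
  · have h' : j ≠ i.rev := fun e => h (by rw [e, Fin.rev_rev])
    rw [Rinv_of_ne_rev q h, Rinv_of_ne_rev q h']
    simp only [K, C_eq, h, if_false, mul_zero, zero_mul, add_zero, sub_zero]
    by_cases hij : i = j
    · subst hij
      by_cases h1 : m = i ∧ n = i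
      · obtain ⟨rfl, rfl⟩ := h1
        simp only [and_self, if_true, le_refl]
        field_simp
        ring
      · have h2 : ¬ (i = n ∧ i = m) := fun e => h1 ⟨e.2.symm, e.1.symm⟩
        simp [h1, h2]
    · by_cases h1 : m = i ∧ n = j
      · obtain ⟨rfl, rfl⟩ := h1
        have e1 : ¬ (m = n ∧ n = m) := fun e => hij e.1
        simp [hij, Ne.symm hij]
        split_ifs <;> ring
      · by_cases h2 : m = j ∧ n = i
        · obtain ⟨rfl, rfl⟩ := h2
          rcases lt_or_gt_of_ne hij with h3 | h3
          · simp [hij, Ne.symm hij, h3.le, h3.not_ge]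
          · simp [hij, Ne.symm hij, h3.le, h3.not_ge]
        · have h3 : ¬ (i = n ∧ j = m) := fun e => h2 ⟨e.2.symm, e.1.symm⟩
          have h4 : ¬ (j = n ∧ i = m) := fun e => h1 ⟨e.2.symm, e.1.symm⟩
          simp [h1, h2, h3, h4]

/-- Crossing symmetry: moving indices with `C` keeps the flip part of the R-matrix but exchanges its
`I`-part with its `K`-part, hence `R⁻` with `R`. The three supports are the cases `hA` (flip), `hB`
(`I` on the left) and `hC` (`K` on the left). -/
theorem c_mul_Rinv {N : ℕ} {q : ℝ} (hq : 0 < q) (k m p r : Fin N) :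
    c q k * Rinv q p r k.rev m = R q k p m r.rev * c q r.rev := by
  have hq0 := hq.ne'
  have hk := c_pos hq k
  have hm := c_pos hq m
  have hr := c_pos hq r
  have a1 : (k.rev = m) = (m = k.rev) := propext eq_comm
  have a2 : (k = m) = (m = k) := propext eq_comm
  by_cases hA : r = k.rev ∧ p = m
  · obtain ⟨rfl, rfl⟩ := hA
    rw [Rinv_eq]
    unfold R K
    simp only [C_eq, Fin.rev_inj, Fin.rev_rev, c_rev_eq_inv hq, a1, a2]
    by_cases h1 : p = k
    · subst h1
      by_cases h2 : p = p.rev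
      · simp [← h2, c_of_rev_eq h2.symm]
      · simp [h2]
        field_simp
        ring
    · by_cases h2 : p = k.rev
      · subst h2
        simp [h1]
        field_simp
      · have h3 : ¬ k = p.rev := fun e => h2 (by rw [e, Fin.rev_rev])
        simp [h1, h2, h3]
  · by_cases hB : p = k.rev ∧ r = m
    · obtain ⟨rfl, rfl⟩ := hB
      have h1 : ¬ r = k.rev := fun e => hA ⟨e, e.symm⟩
      have h2 : ¬ k = r.rev := fun e => h1 (by rw [e, Fin.rev_rev])
      rw [Rinv_eq]
      unfold R K
      simp only [C_eq, Fin.rev_inj, Fin.rev_rev, c_rev_eq_inv hq, a1, a2]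
      by_cases h3 : r = k
      · subst h3
        rcases lt_or_gt_of_ne h1 with h4 | h4
        · simp [h1, Ne.symm h1, h4, h4.le]
          field_simp
          ring
        · simp [h1, Ne.symm h1, h4.not_gt, h4.not_ge]
      · rcases lt_or_gt_of_ne h1 with h4 | h4
        · simp [h1, h3, h4, h4.le]
          field_simp
          ring
        · simp [h1, h4.not_gt, h4.not_ge]
    · by_cases hC : k = m ∧ p = r.rev
      · obtain ⟨rfl, rfl⟩ := hC
        have h1 : ¬ r = k.rev := fun e => hA ⟨e, by rw [e, Fin.rev_rev]⟩
        have h2 : ¬ k = r.rev := fun e => h1 (by rw [e, Fin.rev_rev])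
        have h3 : ¬ r = k := fun e => hB ⟨by rw [e], e⟩
        have e1 : (k < r.rev) = (r < k.rev) := by
          apply propext; rw [← Fin.rev_lt_rev, Fin.rev_rev]
        rw [Rinv_eq]
        unfold R K
        simp only [C_eq, Fin.rev_inj, Fin.rev_rev, c_rev_eq_inv hq, e1]
        rcases lt_or_gt_of_ne h1 with h4 | h4
        · simp [Ne.symm h1, h2, h3, Ne.symm h3, Ne.symm h2, h4, h4.le]
          field_simp
        · simp [Ne.symm h1, h2, h3, h4.not_gt, h4.not_ge, Ne.symm h2]
      · rw [Rinv_eq_zero]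
        · have h1 : ¬ (k = r.rev ∧ m = p) := fun e => hA ⟨by rw [e.1, Fin.rev_rev], e.2.symm⟩
          have h2 : ¬ (m = k ∧ r.rev = p) := fun e => hC ⟨e.1.symm, e.2.symm⟩
          have h3 : K q k p m r.rev = 0 := by
            unfold K
            rw [C_eq, C_eq, Fin.rev_rev]
            split_ifs with b1 b2
            · exact absurd ⟨by rw [b2, Fin.rev_rev], b1.symm⟩ hB
            all_goals simp
          have h4 : ¬ (m = p ∧ r.rev = k) := fun e => h1 ⟨e.2.symm, e.1⟩
          simp [R, h2, h3, h4]
        · exact hB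
        · rintro ⟨rfl, rfl⟩; exact hA ⟨rfl, rfl⟩
        · rintro ⟨e, rfl⟩; exact hC ⟨Fin.rev_inj.1 e, rfl⟩

/-! ### Identities between the scalar coefficients -/

theorem one_sub_sign_mul_zpow_ne_zero {N : ℕ} (hN : 2 ≤ N) {q : ℝ} (hq : 0 < q) (hq1 : q ≠ 1)
    (ε : ℤˣ) : 1 - ((ε : ℤ) : ℝ) * q ^ ((N : ℤ) - 1) ≠ 0 := by
  have hp : 0 < q ^ ((N : ℤ) - 1) := zpow_pos hq _
  rcases Int.units_eq_one_or ε with rfl | rfl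
  · intro h
    have h1 : q ^ ((N : ℤ) - 1) = 1 := by push_cast at h; linarith
    rw [zpow_eq_one_iff_right₀ hq.le hq1] at h1
    omega
  · push_cast
    linarith

theorem sign_sq (ε : ℤˣ) : ((ε : ℤ) : ℝ) * ((ε : ℤ) : ℝ) = 1 := by
  rcases Int.units_eq_one_or ε with rfl | rfl <;> simp

/-- The left-hand side is the coefficient of `x_m θ` in `θ x_m`. -/
theorem sign_mul_add_coeffK_add_coeffC {N : ℕ} (hN : 2 ≤ N) {q : ℝ} (hq : 0 < q) (hq1 : q ≠ 1)
    (ε : ℤˣ) : ((ε : ℤ) : ℝ) * q + coeffK N q ε + coeffC N q ε = 1 := by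
  have hD := one_sub_sign_mul_zpow_ne_zero hN hq hq1 ε
  have hq0 := hq.ne'
  have e1 : q ^ ((N : ℤ) - 1) = q ^ ((N : ℤ) - 2) * q := by
    rw [← zpow_add_one₀ hq0]; congr 1; ring
  have e2 : q ^ (N : ℤ) = q ^ ((N : ℤ) - 2) * q * q := by
    rw [← zpow_add_one₀ hq0, ← zpow_add_one₀ hq0]; congr 1; ring
  rw [coeffK, coeffC, add_assoc, ← add_div, ← eq_sub_iff_add_eq', div_eq_iff hD]
  have he := sign_sq ε
  generalize ((ε : ℤ) : ℝ) = e at *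
  rw [e1, e2] at *
  generalize q ^ ((N : ℤ) - 2) = p at *
  linear_combination -p * q ^ 2 * he

theorem relCoeff_mul {N : ℕ} {q : ℝ} (hq : 0 < q) :
    relCoeff N q * (1 + q ^ ((N : ℤ) - 2)) = q ^ ((N : ℤ) - 2) * (q - q⁻¹) := by
  have hq0 := hq.ne'
  have hp : 0 < q ^ ((N : ℤ) - 2) := zpow_pos hq _
  have e1 : q ^ ((N : ℤ) - 1) = q ^ ((N : ℤ) - 2) * q := by
    rw [← zpow_add_one₀ hq0]; congr 1; ring
  have e2 : q ^ ((N : ℤ) - 3) = q ^ ((N : ℤ) - 2) * q⁻¹ := by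
    rw [← zpow_sub_one₀ hq0]; congr 1; ring
  rw [relCoeff, div_mul_cancel₀ _ (by positivity), e1, e2]
  ring

/-- The scalar `γ` in the commutation rule `θ x_m = x_m θ + γ dx_m`, `θ = C^{kl} x_k dx_l`. -/
def coeffComm (N : ℕ) (q : ℝ) (ε : ℤˣ) : ℝ :=
  ((ε : ℤ) : ℝ) * q - 1 + ((ε : ℤ) : ℝ) * (relCoeff N q - (q - q⁻¹))

/-- This identity kills the terms `R⁻(x dx)` and `x_i x_j θ` in the dual relation. -/
theorem coeffC_mul_coeffComm {N : ℕ} (hN : 2 ≤ N) {q : ℝ} (hq : 0 < q) (hq1 : q ≠ 1)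
    (ε : ℤˣ) : coeffC N q ε * coeffComm N q ε =
      ((ε : ℤ) : ℝ) * q + ((ε : ℤ) : ℝ) * q⁻¹ - 2 := by
  have hD := one_sub_sign_mul_zpow_ne_zero hN hq hq1 ε
  have hq0 := hq.ne'
  have e1 : q ^ ((N : ℤ) - 1) = q ^ ((N : ℤ) - 2) * q := by
    rw [← zpow_add_one₀ hq0]; congr 1; ring
  have hk := relCoeff_mul (N := N) hq
  rw [coeffC, coeffComm, div_mul_eq_mul_div, div_eq_iff hD]
  have he := sign_sq ε
  have hqi : q * q⁻¹ = 1 := mul_inv_cancel₀ hq0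
  generalize ((ε : ℤ) : ℝ) = e at *
  rw [e1] at *
  generalize q ^ ((N : ℤ) - 2) = p at *
  generalize relCoeff N q = κ at *
  generalize q⁻¹ = r at *
  linear_combination (1 - e * q) * e * hk - (1 - p) * q * r * he - (1 - p) * hqi

/-- What remains of the coefficient of `C^{ij} θ` in the dual relation after `coeffC_mul_coeffComm`
has been used. -/
theorem coeff_relation {N : ℕ} (hN : 2 ≤ N) {q : ℝ} (hq : 0 < q) (hq1 : q ≠ 1) (ε : ℤˣ) :
    (q - q⁻¹) * q ^ ((N : ℤ) - 1) + ((ε : ℤ) : ℝ) * coeffK N q ε * q ^ ((N : ℤ) - 1)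
      + ((ε : ℤ) : ℝ) * coeffC N q ε * relCoeff N q - ((ε : ℤ) : ℝ) * q⁻¹ * coeffK N q ε = 0 := by
  have hD := one_sub_sign_mul_zpow_ne_zero hN hq hq1 ε
  have hq0 := hq.ne'
  have e1 : q ^ ((N : ℤ) - 1) = q ^ ((N : ℤ) - 2) * q := by
    rw [← zpow_add_one₀ hq0]; congr 1; ring
  have e2 : q ^ (N : ℤ) = q ^ ((N : ℤ) - 2) * q * q := by
    rw [← zpow_add_one₀ hq0, ← zpow_add_one₀ hq0]; congr 1; ring
  have hk := relCoeff_mul (N := N) hq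
  have ha : coeffK N q ε * (1 - ((ε : ℤ) : ℝ) * q ^ ((N : ℤ) - 1)) =
    q ^ (N : ℤ) - q ^ ((N : ℤ) - 2) := div_mul_cancel₀ _ hD
  have hb : coeffC N q ε * (1 - ((ε : ℤ) : ℝ) * q ^ ((N : ℤ) - 1)) =
    (1 - ((ε : ℤ) : ℝ) * q) * (1 + q ^ ((N : ℤ) - 2)) := div_mul_cancel₀ _ hD
  have he := sign_sq ε
  have hqi : q * q⁻¹ = 1 := mul_inv_cancel₀ hq0
  -- Multiplying by the common denominator leaves an identity modulo `ε² = 1`, `q q⁻¹ = 1` and the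
  -- equations `ha`, `hb`, `hk`.
  refine (mul_eq_zero.1 ?_).resolve_right hD
  generalize coeffK N q ε = a at *
  generalize coeffC N q ε = b at *
  generalize ((ε : ℤ) : ℝ) = e at *
  rw [e1] at *
  rw [e2] at *
  generalize q ^ ((N : ℤ) - 2) = p at *
  generalize relCoeff N q = κ at *
  generalize q⁻¹ = r at *
  linear_combination (e * p * q - e * r) * ha + e * κ * hb + e * (1 - e * q) * hk
    + p * (e * p * q - e * q) * hqi - p * (q - r) * q * he

/-! ### Matrices acting on families indexed by pairs -/

theorem sum_comm_four {ι M : Type*} [Fintype ι] [AddCommMonoid M] (f : ι → ι → ι → ι → M) :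
    ∑ k, ∑ l, ∑ m, ∑ n, f k l m n = ∑ m, ∑ n, ∑ k, ∑ l, f k l m n := by
  have h : ∀ g : ι → ι → M, ∑ a, ∑ b, g a b = ∑ p : ι × ι, g p.1 p.2 := fun g =>
    (Fintype.sum_prod_type' g).symm
  simp only [h]
  exact Finset.sum_comm

section Action

variable {N : ℕ} {q : ℝ} {M : Type*} [AddCommGroup M] [Module ℂ M]

/-- The action of a matrix `F^{kl}_{ij}` on a family of vectors `v_{kl}`. -/
def act (F : Fin N → Fin N → Fin N → Fin N → ℝ) (v : Fin N → Fin N → M) (i j : Fin N) : M :=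
  ∑ k, ∑ l, ((F k l i j : ℝ) : ℂ) • v k l

/-- The contraction `C^{kl} v_{kl}`. -/
def contract (q : ℝ) (v : Fin N → Fin N → M) : M := ∑ k, ∑ l, ((C q k l : ℝ) : ℂ) • v k l

theorem act_add (F : Fin N → Fin N → Fin N → Fin N → ℝ) (v w : Fin N → Fin N → M) (i j : Fin N) :
    act F (fun k l => v k l + w k l) i j = act F v i j + act F w i j := by
  simp [act, Finset.sum_add_distrib]

theorem act_smul (F : Fin N → Fin N → Fin N → Fin N → ℝ) (r : ℂ) (v : Fin N → Fin N → M)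
    (i j : Fin N) : act F (fun k l => r • v k l) i j = r • act F v i j := by
  simp only [act, Finset.smul_sum, smul_comm r]

theorem contract_add (v w : Fin N → Fin N → M) :
    contract q (fun k l => v k l + w k l) = contract q v + contract q w := by
  simp [contract, Finset.sum_add_distrib]

theorem contract_smul (r : ℂ) (v : Fin N → Fin N → M) :
    contract q (fun k l => r • v k l) = r • contract q v := by
  simp only [contract, Finset.smul_sum, smul_comm r]

theorem contract_eq_sum (v : Fin N → Fin N → M) :
    contract q v = ∑ k, ((c q k : ℝ) : ℂ) • v k k.rev := by
  refine Finset.sum_congr rfl fun k _ => ?_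
  rw [Finset.sum_eq_single k.rev]
  · simp [C_eq]
  · intro l _ h
    have : ¬ k = l.rev := fun e => h (by rw [e, Fin.rev_rev])
    simp [C_eq, this]
  · simp

theorem contract_eq_sum' (v : Fin N → Fin N → M) :
    contract q v = ∑ l, ((c q l.rev : ℝ) : ℂ) • v l.rev l := by
  rw [contract, Finset.sum_comm]
  refine Finset.sum_congr rfl fun l _ => ?_
  simp [C_eq]

theorem act_K (v : Fin N → Fin N → M) (i j : Fin N) :
    act (K q) v i j = ((C q i j : ℝ) : ℂ) • contract q v := by
  simp only [act, contract, K, Finset.smul_sum, smul_smul, Complex.ofReal_mul]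

theorem act_act (F G : Fin N → Fin N → Fin N → Fin N → ℝ) (v : Fin N → Fin N → M) (i j : Fin N) :
    act F (act G v) i j = act (fun m n i j => ∑ k, ∑ l, F k l i j * G m n k l) v i j := by
  simp only [act, Finset.smul_sum, Complex.ofReal_sum, Finset.sum_smul, smul_smul,
    Complex.ofReal_mul]
  rw [sum_comm_four]

theorem act_Rinv_act_Rinv (hq : 0 < q) (v : Fin N → Fin N → M) (i j : Fin N) :
    act (Rinv q) (act (Rinv q) v) i j = v i j - ((q - q⁻¹ : ℝ) : ℂ) • act (Rinv q) v i j
      + (((q - q⁻¹) * q ^ ((N : ℤ) - 1) : ℝ) : ℂ) • ((C q i j : ℝ) : ℂ) • contract q v := by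
  rw [act_act, ← act_K]
  simp only [sum_Rinv_mul_Rinv hq, act, Complex.ofReal_add, Complex.ofReal_sub,
    Complex.ofReal_mul _ (Rinv _ _ _ _ _), Complex.ofReal_mul _ (K _ _ _ _ _), add_smul, sub_smul,
    Finset.sum_add_distrib, Finset.sum_sub_distrib, Finset.smul_sum, mul_smul]
  congr 2
  rw [Finset.sum_eq_single i, Finset.sum_eq_single j]
  · simp
  · intro b _ hb; simp [hb]
  · simp
  · intro b _ hb; simp [hb]
  · simp

theorem act_Rinv_C (hq : 0 < q) (m : M) (i j : Fin N) :
    act (Rinv q) (fun k l => ((C q k l : ℝ) : ℂ) • m) i j =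
      ((q ^ ((N : ℤ) - 1) : ℝ) : ℂ) • ((C q i j : ℝ) : ℂ) • m := by
  rw [smul_smul, ← Complex.ofReal_mul, ← sum_Rinv_mul_C hq]
  simp only [act, smul_smul, Complex.ofReal_sum, Finset.sum_smul, Complex.ofReal_mul]

end Action

/-! ### The invariant form `θ` and the dual relations -/

section DualRelation

variable {N : ℕ} {q : ℝ} {Γ : Type*} [AddCommGroup Γ] [Module ℂ Γ] [Module (Sphere N q) Γ]
  [Module (Sphere N q)ᵐᵒᵖ Γ]

theorem act_K_x (i j : Fin N) :
    act (K q) (fun k l => x q k * x q l) i j = ((C q i j : ℝ) : ℂ) • (1 : Sphere N q) := by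
  rw [act_K, contract, sphere_rel]

theorem act_Rinv_x (i j : Fin N) :
    act (Rinv q) (fun k l => x q k * x q l) i j = ((q⁻¹ : ℝ) : ℂ) • (x q i * x q j)
      + ((relCoeff N q : ℝ) : ℂ) • ((C q i j : ℝ) : ℂ) • (1 : Sphere N q) := by
  rw [← act_K_x]
  exact comm_rel q i j

theorem act_R_x (i j : Fin N) :
    act (R q) (fun k l => x q k * x q l) i j = ((q : ℝ) : ℂ) • (x q i * x q j)
      + ((relCoeff N q - (q - q⁻¹) : ℝ) : ℂ) • ((C q i j : ℝ) : ℂ) • (1 : Sphere N q) := by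
  have h : R q = fun k l i j : Fin N => Rinv q k l i j
      + (q - q⁻¹) * (if k = i ∧ l = j then (1 : ℝ) else 0) - (q - q⁻¹) * K q k l i j := by
    funext k l i j
    rw [Rinv]; ring
  have h2 : act (R q) (fun k l => x q k * x q l) i j =
      act (Rinv q) (fun k l => x q k * x q l) i j + ((q - q⁻¹ : ℝ) : ℂ) • (x q i * x q j)
        - ((q - q⁻¹ : ℝ) : ℂ) • act (K q) (fun k l => x q k * x q l) i j := by
    rw [h]
    simp only [act, Complex.ofReal_add, Complex.ofReal_sub,
      Complex.ofReal_mul, add_smul, sub_smul,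
      Finset.sum_add_distrib, Finset.sum_sub_distrib, Finset.smul_sum, mul_smul]
    simp only [← Finset.smul_sum]
    have : ∑ k, ∑ l, (((if k = i ∧ l = j then (1 : ℝ) else 0 : ℝ)) : ℂ) • (x q k * x q l) =
        x q i * x q j := by
      rw [Finset.sum_eq_single i, Finset.sum_eq_single j]
      · simp
      · intro b _ hb; simp [hb]
      · simp
      · intro b _ hb; simp [hb]
      · simp
    rw [this]
  rw [h2, act_Rinv_x, act_K_x]
  push_cast
  module

variable [SMulCommClass (Sphere N q) (Sphere N q)ᵐᵒᵖ Γ] [IsScalarTower ℂ (Sphere N q) Γ]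
  [IsScalarTower ℂ (Sphere N q)ᵐᵒᵖ Γ]

/-- The invariant one-form `C^{kl} x_k dx_l`. -/
def theta (D : Calculus (Sphere N q) Γ) : Γ := contract q fun k l => x q k • D.d (x q l)

theorem prescribed_eq (ε : ℤˣ) (D : Calculus (Sphere N q) Γ) (i j : Fin N) :
    prescribed ε D.d i j =
      (((ε : ℤ) : ℝ) : ℂ) • act (Rinv q) (fun k l => x q k • D.d (x q l)) i j
      + ((((ε : ℤ) : ℝ) * q - 1 : ℝ) : ℂ) • (x q i • D.d (x q j))
      + ((coeffK N q ε : ℝ) : ℂ) • ((C q i j : ℝ) : ℂ) • theta D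
      + ((coeffC N q ε : ℝ) : ℂ) • ((x q i * x q j) • theta D) := by
  have h1 : (x q i * x q j) • theta D =
      ∑ k, ∑ l, ((C q k l : ℝ) : ℂ) • ((x q i * x q j * x q k) • D.d (x q l)) := by
    simp only [theta, contract, Finset.smul_sum, mul_smul]
    simp only [smul_algebra_smul_comm]
  rw [h1, theta, ← act_K]
  rfl

theorem d_one (D : Calculus (Sphere N q) Γ) : D.d 1 = 0 := by
  have := D.leibniz 1 1
  simpa using this

/-- Apply `d` to `C^{kl} x_k x_l = 1` and use `d 1 = 0`. -/
theorem contract_d_x (D : Calculus (Sphere N q) Γ) :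
    contract q (fun k l => MulOpposite.op (x q l) • D.d (x q k)) = - theta D := by
  have h := congrArg D.d (sphere_rel N q)
  simp only [map_sum, map_smul, D.leibniz, smul_add, Finset.sum_add_distrib, d_one] at h
  exact eq_neg_of_add_eq_zero_left h

/-- Each term of the relation for `dx_l · x_m` is contracted with `C^{kl} x_k`. The `K`- and
`C`-terms give multiples of `x_m θ`, the middle term a multiple of `dx_m`, and the `R⁻`-term some of
each. -/
theorem op_x_smul_theta (hN : 2 ≤ N) (hq : 0 < q) (hq1 : q ≠ 1) {ε : ℤˣ}
    {D : Calculus (Sphere N q) Γ} (hD : HasStructure ε D) (m : Fin N) :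
    MulOpposite.op (x q m) • theta D =
      x q m • theta D + ((coeffComm N q ε : ℝ) : ℂ) • D.d (x q m) := by
  have e1 : MulOpposite.op (x q m) • theta D =
      contract q (fun k l => x q k • prescribed ε D.d l m) := by
    simp only [theta, contract, Finset.smul_sum]
    refine Finset.sum_congr rfl fun k _ => Finset.sum_congr rfl fun l _ => ?_
    rw [← hD l m, smul_comm (x q k), smul_algebra_smul_comm]
  have e2 : contract q (fun k l => x q k •
      act (Rinv q) (fun k l => x q k • D.d (x q l)) l m) =
      (q : ℂ) • x q m • theta D + ((relCoeff N q - (q - q⁻¹) : ℝ) : ℂ) • D.d (x q m) := by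
    -- Crossing makes `R` act on two coordinates, with the differential outside, so that the
    -- commutation relations of the sphere apply.
    have e3 : contract q (fun k l => x q k •
      act (Rinv q) (fun k l => x q k • D.d (x q l)) l m) =
      ∑ r : Fin N, ((c q r.rev : ℝ) : ℂ) •
        (act (R q) (fun k l => x q k * x q l) m r.rev • D.d (x q r)) := by
      rw [contract_eq_sum]
      simp only [act, Finset.smul_sum, Finset.sum_smul, smul_algebra_smul_comm, smul_assoc,
        mul_smul, smul_smul ((c q _ : ℝ) : ℂ), ← Complex.ofReal_mul, c_mul_Rinv hq]
      rw [eq_comm, Finset.sum_comm]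
      refine Finset.sum_congr rfl fun k _ => ?_
      rw [Finset.sum_comm]
      refine Finset.sum_congr rfl fun p _ => Finset.sum_congr rfl fun r _ => ?_
      rw [mul_comm]
    rw [e3]
    simp only [act_R_x, add_smul, smul_add, Finset.sum_add_distrib]
    congr 1
    · rw [theta, contract_eq_sum']
      simp only [Finset.smul_sum]
      refine Finset.sum_congr rfl fun r _ => ?_
      rw [smul_assoc, mul_smul, smul_algebra_smul_comm (c q r.rev : ℂ),
        smul_comm (q : ℂ) (c q r.rev : ℂ)]
    · rw [Finset.sum_eq_single m]
      · simp only [C_eq, Fin.rev_rev, if_true, smul_assoc, one_smul]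
        rw [smul_comm, smul_smul ((c q m.rev : ℝ) : ℂ), ← Complex.ofReal_mul, c_rev_mul hq]
        simp
      · intro r _ hr
        simp [C_eq, Ne.symm hr]
      · simp
  have e4 : contract q (fun k l : Fin N => x q k • x q l • D.d (x q m)) = D.d (x q m) := by
    have := congrArg (fun a => a • D.d (x q m)) (sphere_rel N q)
    simp only [Finset.sum_smul, one_smul, smul_assoc, mul_smul] at this
    exact this
  have e5 : contract q (fun k l => x q k • ((C q l m : ℝ) : ℂ) • theta D) = x q m • theta D := by
    rw [contract_eq_sum, Finset.sum_eq_single m]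
    · simp only [C_eq, if_true]
      rw [smul_algebra_smul_comm, smul_smul, ← Complex.ofReal_mul, c_mul_rev hq]
      simp
    · intro k _ hk
      simp [C_eq, Fin.rev_inj, hk]
    · simp
  have e6 : contract q (fun k l => x q k • (x q l * x q m) • theta D) = x q m • theta D := by
    have := congrArg (fun a => a • x q m • theta D) (sphere_rel N q)
    simp only [Finset.sum_smul, one_smul, smul_assoc, mul_smul] at this
    simp only [mul_smul]
    exact this
  have e7 : ∀ k l : Fin N, x q k • prescribed ε D.d l m =
      (((ε : ℤ) : ℝ) : ℂ) • (x q k • act (Rinv q) (fun k l => x q k • D.d (x q l)) l m)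
      + ((((ε : ℤ) : ℝ) * q - 1 : ℝ) : ℂ) • (x q k • x q l • D.d (x q m))
      + ((coeffK N q ε : ℝ) : ℂ) • (x q k • ((C q l m : ℝ) : ℂ) • theta D)
      + ((coeffC N q ε : ℝ) : ℂ) • (x q k • (x q l * x q m) • theta D) := by
    intro k l
    rw [prescribed_eq]
    simp only [smul_add, mul_smul,
      smul_algebra_smul_comm (A := Sphere N q) (((ε : ℤ) : ℝ) : ℂ),
      smul_algebra_smul_comm (A := Sphere N q) ((((ε : ℤ) : ℝ) * q - 1 : ℝ) : ℂ),
      smul_algebra_smul_comm (A := Sphere N q) ((coeffK N q ε : ℝ) : ℂ),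
      smul_algebra_smul_comm (A := Sphere N q) ((coeffC N q ε : ℝ) : ℂ)]
  have hs : (((((ε : ℤ) : ℝ) * q + coeffK N q ε + coeffC N q ε : ℝ)) : ℂ) = 1 := by
    rw [sign_mul_add_coeffK_add_coeffC hN hq hq1, Complex.ofReal_one]
  simp only [e1, e7, contract_add, contract_smul, e2, e4, e5, e6, coeffComm]
  push_cast at hs ⊢
  generalize x q m • theta D = u
  linear_combination (norm := module) hs • u

/-- The relations obtained from those of `Γ_ε` by applying the involution. -/
theorem dual_relation (hN : 2 ≤ N) (hq : 0 < q) (hq1 : q ≠ 1) {ε : ℤˣ}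
    {D : Calculus (Sphere N q) Γ} (hD : HasStructure ε D) (i j : Fin N) :
    x q i • D.d (x q j) =
      (((ε : ℤ) : ℝ) : ℂ) • act (Rinv q) (fun k l => MulOpposite.op (x q l) • D.d (x q k)) i j
      + ((((ε : ℤ) : ℝ) * q - 1 : ℝ) : ℂ) • (MulOpposite.op (x q j) • D.d (x q i))
      + ((coeffK N q ε : ℝ) : ℂ) • act (K q) (fun k l => MulOpposite.op (x q l) • D.d (x q k)) i j
      + ((coeffC N q ε : ℝ) : ℂ) • (MulOpposite.op (x q i * x q j) •
          contract q (fun k l => MulOpposite.op (x q l) • D.d (x q k))) := by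
  rw [act_K, contract_d_x]
  have hY : ∀ i j, MulOpposite.op (x q j) • D.d (x q i) = _ := fun i j =>
    (hD i j).trans (prescribed_eq ε D i j)
  have hZ : act (Rinv q) (fun k l => (x q k * x q l) • theta D) i j =
      ((q⁻¹ : ℝ) : ℂ) • ((x q i * x q j) • theta D)
      + ((relCoeff N q : ℝ) : ℂ) • ((C q i j : ℝ) : ℂ) • theta D := by
    have := congrArg (fun a => a • theta D) (act_Rinv_x (q := q) i j)
    simp only [act, Finset.sum_smul, smul_assoc, add_smul, one_smul] at this
    exact this
  -- The commutation rule for `θ` is used twice: first for `x_i`, the factor next to `θ`, then for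
  -- `x_j`.
  have hθ : MulOpposite.op (x q i * x q j) • theta D = (x q i * x q j) • theta D
      + ((coeffComm N q ε : ℝ) : ℂ) • (x q i • D.d (x q j))
      + ((coeffComm N q ε : ℝ) : ℂ) • (MulOpposite.op (x q j) • D.d (x q i)) := by
    rw [MulOpposite.op_mul, mul_smul, op_x_smul_theta hN hq hq1 hD, smul_add,
      ← smul_comm (x q i), op_x_smul_theta hN hq hq1 hD, smul_add, smul_algebra_smul_comm,
      smul_algebra_smul_comm, mul_smul]
  have hWY : act (Rinv q) (fun k l => MulOpposite.op (x q l) • D.d (x q k)) i j =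
      (((ε : ℤ) : ℝ) : ℂ) • (x q i • D.d (x q j)
        - ((q - q⁻¹ : ℝ) : ℂ) • act (Rinv q) (fun k l => x q k • D.d (x q l)) i j
        + (((q - q⁻¹) * q ^ ((N : ℤ) - 1) : ℝ) : ℂ) • ((C q i j : ℝ) : ℂ) • theta D)
      + ((((ε : ℤ) : ℝ) * q - 1 : ℝ) : ℂ) •
          act (Rinv q) (fun k l => x q k • D.d (x q l)) i j
      + ((coeffK N q ε : ℝ) : ℂ) • ((q ^ ((N : ℤ) - 1) : ℝ) : ℂ) • ((C q i j : ℝ) : ℂ) • theta D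
      + ((coeffC N q ε : ℝ) : ℂ) • (((q⁻¹ : ℝ) : ℂ) • ((x q i * x q j) • theta D)
        + ((relCoeff N q : ℝ) : ℂ) • ((C q i j : ℝ) : ℂ) • theta D) := by
    simp only [hY, act_add, act_smul]
    rw [act_Rinv_act_Rinv hq, act_Rinv_C hq, hZ]
    rfl
  rw [smul_neg (MulOpposite.op (x q i * x q j)), hθ, hWY, hY]
  have he := congrArg ((↑) : ℝ → ℂ) (sign_sq ε)
  have h2 := congrArg ((↑) : ℝ → ℂ) (coeffC_mul_coeffComm hN hq hq1 ε)
  have h3 := congrArg ((↑) : ℝ → ℂ) (coeff_relation hN hq hq1 ε)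
  have hqi : (q : ℂ) * (q : ℂ)⁻¹ = 1 := mul_inv_cancel₀ (by exact_mod_cast hq.ne')
  generalize act (Rinv q) (fun k l => x q k • D.d (x q l)) i j = w
  generalize (x q i * x q j) • theta D = z
  generalize x q i • D.d (x q j) = u
  generalize hv : ((C q i j : ℝ) : ℂ) • theta D = v
  rw [smul_neg, hv]
  push_cast at he h2 h3 ⊢
  generalize (((ε : ℤ) : ℂ)) = e at *
  generalize ((coeffK N q ε : ℝ) : ℂ) = a at *
  generalize ((coeffC N q ε : ℝ) : ℂ) = b at *
  generalize ((coeffComm N q ε : ℝ) : ℂ) = g at *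
  generalize (q : ℂ) ^ ((N : ℤ) - 1) = y at *
  -- Coefficients are compared on both sides: those of `w`, `z` and `v` vanish, and that of `u = x_i
  -- dx_j` becomes `1`.
  linear_combination (norm := module) (e * h2) • w + (e * q * h2 + e ^ 2 * hqi) • u + (b * h2) • z
    + (a * h2 - h3 - (q - (q : ℂ)⁻¹) * y * he) • v

end DualRelation

/-! ### The involution applied to the bimodule relations -/

section StarOfPrescribed

variable {N : ℕ} {q : ℝ} [hq : Fact (0 < q)] {Γ : Type*} [AddCommGroup Γ] [Module ℂ Γ]
  [Module (Sphere N q) Γ] [Module (Sphere N q)ᵐᵒᵖ Γ]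
  [SMulCommClass (Sphere N q) (Sphere N q)ᵐᵒᵖ Γ] [IsScalarTower ℂ (Sphere N q) Γ]
  [IsScalarTower ℂ (Sphere N q)ᵐᵒᵖ Γ]

theorem star_x_eq (i : Fin N) : star (x q i) = ((c q i : ℝ) : ℂ) • x q i.rev :=
  (star_x i).trans (xs_eq q i)

/-- Reflecting the summation indices in a quadratic expression with one differential. -/
theorem sum_star_smul_d_star (D : Calculus (Sphere N q) Γ) (F G : Fin N → Fin N → ℝ) (t : ℝ)
    (h : ∀ k l, c q k * c q l * F k l = t * G l.rev k.rev) :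
    ∑ k, ∑ l, ((F k l : ℝ) : ℂ) • (MulOpposite.op (star (x q k)) • D.d (star (x q l))) =
      (t : ℂ) • ∑ k, ∑ l, ((G k l : ℝ) : ℂ) • (MulOpposite.op (x q l) • D.d (x q k)) := by
  rw [Finset.sum_comm, Finset.smul_sum, ← Equiv.sum_comp Fin.revPerm]
  refine Finset.sum_congr rfl fun l _ => ?_
  rw [Finset.smul_sum, ← Equiv.sum_comp Fin.revPerm]
  refine Finset.sum_congr rfl fun k _ => ?_
  have := h k.rev l.rev
  simp only [Fin.rev_rev] at this
  simp only [Fin.revPerm_apply, star_x_eq, Fin.rev_rev, map_smul, MulOpposite.op_smul]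
  rw [smul_assoc, smul_algebra_smul_comm (A := (Sphere N q)ᵐᵒᵖ), smul_smul, smul_smul, smul_smul]
  congr 1
  rw [← Complex.ofReal_mul t, ← this]
  push_cast; ring

variable {M : Type*} [AddCommGroup M] [Module ℂ M] [Module (Sphere N q) M]

/-- A conjugate-linear map which reverses products and commutes with the differentials maps the
prescribed value of `dx_i · x_j` to `x_j^* · d(x_i^*)`. -/
theorem map_prescribed (hN : 2 ≤ N) (hq1 : q ≠ 1) {ε : ℤˣ} {D : Calculus (Sphere N q) Γ}
    (hD : HasStructure ε D) (s : M →+ Γ)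
    (hs : ∀ (r : ℂ) (m : M), s (r • m) = starRingEnd ℂ r • s m)
    (hl : ∀ (a : Sphere N q) (m : M), s (a • m) = MulOpposite.op (star a) • s m)
    (δ : Sphere N q → M) (hδ : ∀ l, s (δ (x q l)) = D.d (star (x q l))) (i j : Fin N) :
    s (prescribed ε δ i j) = star (x q j) • D.d (star (x q i)) := by
  have hC : ∀ k l : Fin N, c q k * c q l * C q k l = 1 * C q l.rev k.rev := by
    intro k l
    rw [C_eq, C_eq]
    by_cases h : k = l.rev
    · subst h
      simp [c_rev_mul hq.out l]
    · rw [if_neg h, if_neg (fun e => h (by rw [e, Fin.rev_rev]))]; simp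
  simp only [prescribed, map_add, hs, map_sum, Complex.conj_ofReal, hl, hδ, mul_smul]
  have e1 := sum_star_smul_d_star D (fun k l => Rinv q k l i j)
    (fun k l => Rinv q k l j.rev i.rev) (c q i * c q j) (fun k l => Rinv_rev hq.out k l i j)
  have e2 := sum_star_smul_d_star D (fun k l => K q k l i j)
    (fun k l => K q k l j.rev i.rev) (c q i * c q j) (fun k l => K_rev hq.out k l i j)
  have e3 := sum_star_smul_d_star D (fun k l => C q k l) (fun k l => C q k l) 1 hC
  have e4 : ∑ k, ∑ l, ((C q k l : ℝ) : ℂ) • (MulOpposite.op (star (x q i)) •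
      MulOpposite.op (star (x q j)) • MulOpposite.op (star (x q k)) • D.d (star (x q l))) =
      ((c q i * c q j : ℝ) : ℂ) • (MulOpposite.op (x q j.rev * x q i.rev) •
        contract q (fun k l => MulOpposite.op (x q l) • D.d (x q k))) := by
    rw [Complex.ofReal_one, one_smul] at e3
    rw [contract, ← e3, star_x_eq i, star_x_eq j, MulOpposite.op_smul, MulOpposite.op_smul]
    simp only [Finset.smul_sum, MulOpposite.op_mul, mul_smul, smul_assoc]
    refine Finset.sum_congr rfl fun k _ => Finset.sum_congr rfl fun l _ => ?_
    generalize MulOpposite.op (star (x q k)) • D.d (star (x q l)) = u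
    rw [smul_algebra_smul_comm (A := (Sphere N q)ᵐᵒᵖ) ((c q j : ℝ) : ℂ),
      smul_algebra_smul_comm (A := (Sphere N q)ᵐᵒᵖ) ((C q k l : ℝ) : ℂ),
      smul_algebra_smul_comm (A := (Sphere N q)ᵐᵒᵖ) ((C q k l : ℝ) : ℂ)]
    simp only [smul_smul]
    push_cast
    congr 1
    ring
  -- The involution sends `(i, j)` to `(j', i')` with the factor `c_i c_j`.
  have hdual := dual_relation hN hq.out hq1 hD j.rev i.rev
  rw [e1, e2, e4]
  have e5 : star (x q j) • D.d (star (x q i)) =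
      ((c q i * c q j : ℝ) : ℂ) • (x q j.rev • D.d (x q i.rev)) := by
    rw [star_x_eq, star_x_eq, map_smul, smul_assoc, smul_algebra_smul_comm, smul_smul,
      ← Complex.ofReal_mul, mul_comm]
  have e6 : MulOpposite.op (star (x q i)) • D.d (star (x q j)) =
      ((c q i * c q j : ℝ) : ℂ) • (MulOpposite.op (x q i.rev) • D.d (x q j.rev)) := by
    rw [star_x_eq, star_x_eq, map_smul, MulOpposite.op_smul, smul_assoc,
      smul_algebra_smul_comm, smul_smul, ← Complex.ofReal_mul]
  rw [e5, e6, hdual]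
  simp only [act, smul_add, smul_comm ((c q i * c q j : ℝ) : ℂ)]

end StarOfPrescribed

/-! ### From a left-reversing map to a `*`-calculus -/

section StarCalculus

theorem map_conj_smul_of_map_left {A M Γ : Type*} [Ring A] [Algebra ℂ A] [StarRing A]
    [StarModule ℂ A] [AddCommGroup M] [Module ℂ M] [Module A M] [IsScalarTower ℂ A M]
    [AddCommGroup Γ] [Module ℂ Γ] [Module Aᵐᵒᵖ Γ] [IsScalarTower ℂ Aᵐᵒᵖ Γ] {s : M → Γ}
    (hl : ∀ (a : A) (ω : M), s (a • ω) = MulOpposite.op (star a) • s ω) (r : ℂ) (ω : M) :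
    s (r • ω) = starRingEnd ℂ r • s ω := by
  rw [← one_smul A ω, ← smul_assoc, hl, hl, star_smul, star_one, MulOpposite.op_smul, smul_assoc]
  rfl

variable {A Γ : Type*} [Ring A] [Algebra ℂ A] [StarRing A] [StarModule ℂ A] [AddCommGroup Γ]
  [Module ℂ Γ] [Module A Γ] [Module Aᵐᵒᵖ Γ] [SMulCommClass A Aᵐᵒᵖ Γ] [IsScalarTower ℂ A Γ]
  [IsScalarTower ℂ Aᵐᵒᵖ Γ]

/-- An additive map which reverses left products and satisfies `(da)^* = d(a^*)` makes a
calculus a `*`-calculus and is the only involution of the one-forms. -/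
theorem Calculus.isStarCalculus_of_map (D : Calculus A Γ) (s : Γ →+ Γ)
    (hl : ∀ (a : A) (ω : Γ), s (a • ω) = MulOpposite.op (star a) • s ω)
    (hd : ∀ a : A, s (D.d a) = D.d (star a)) :
    D.IsStarCalculus ∧ ∃! s, D.IsFormStar s := by
  -- Forms are sums of terms `a db`; right reversal, involutivity and uniqueness need checking only
  -- on these.
  have hind : ∀ {p : Γ → Prop} (ω : Γ), (∀ a b : A, p (a • D.d b)) → p 0 →
      (∀ ω η, p ω → p η → p (ω + η)) → p ω := by
    intro p ω h1 h0 h2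
    obtain ⟨n, a, g, rfl⟩ := Submodule.mem_span_set'.1
      (show ω ∈ Submodule.span A (Set.range D.d) by rw [D.span_range]; trivial)
    refine Finset.sum_induction _ p h2 h0 fun i _ => ?_
    obtain ⟨b, hb⟩ := (g i).2
    rw [← hb]
    exact h1 _ _
  have hr : ∀ (c : A) (ω : Γ), s (MulOpposite.op c • ω) = star c • s ω := by
    intro c ω
    refine hind (p := fun ω => s (MulOpposite.op c • ω) = star c • s ω) ω ?_ ?_ ?_
    · intro a b
      -- The Leibniz rule eliminates right multiplication, so `hl` and `hd` determine the image.
      have h1 : MulOpposite.op c • a • D.d b = a • D.d (b * c) - (a * b) • D.d c := by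
        rw [D.leibniz, smul_add, ← smul_comm a, mul_smul]; abel
      rw [h1, map_sub, hl, hl, hd, hd, hl, hd, star_mul, star_mul, D.leibniz, smul_add,
        MulOpposite.op_mul, mul_smul, smul_comm (star c)]
      abel
    · simp
    · intro ω η h1 h2
      rw [smul_add, map_add, map_add, smul_add, h1, h2]
  refine ⟨?_, s, ⟨map_add s, map_conj_smul_of_map_left hl, hl, hr, ?_, hd⟩, ?_⟩
  · intro n a b h
    have := congrArg s h
    simpa [hl, hd] using this
  · intro ω
    refine hind (p := fun ω => s (s ω) = ω) ω ?_ ?_ ?_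
    · intro a b
      rw [hl, hr, hd, hd, star_star, star_star]
    · simp
    · intro ω η h1 h2
      rw [map_add, map_add, h1, h2]
  · intro t ht
    funext ω
    refine hind (p := fun ω => t ω = s ω) ω ?_ ?_ ?_
    · intro a b
      rw [hl, hd, ht.map_left, ht.map_d]
    · have := ht.map_add 0 0
      simp at this
      simp [this]
    · intro ω η h1 h2
      rw [map_add, ht.map_add, h1, h2]

end StarCalculus

/-! ### The involution of the universal calculus and its quotients -/

section UniversalStar

theorem env_mul_neg {A : Type*} [Ring A] [Algebra ℂ A] (e f : Env A) : e * -f = -(e * f) :=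
  eq_neg_of_add_eq_zero_left (by rw [← mul_add, neg_add_cancel, mul_zero])

variable (A : Type*) [Ring A] [Algebra ℂ A] [StarRing A] [StarModule ℂ A]

/-- The additive map `a ⊗ op b ↦ b^* ⊗ op a^*`. -/
def envStarAdd : Env A →+ Env A :=
  TensorProduct.liftAddHom
    { toFun := fun a =>
        { toFun := fun b => star b.unop ⊗ₜ[ℂ] MulOpposite.op (star a)
          map_zero' := by simp
          map_add' := fun b b' => by simp [TensorProduct.add_tmul] }
      map_zero' := by ext; simp
      map_add' := fun a a' => by ext; simp [TensorProduct.tmul_add] }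
    (fun r a b => by simp [TensorProduct.smul_tmul])

/-- The conjugate-linear ring homomorphism `a ⊗ op b ↦ b^* ⊗ op a^*`. -/
def envStar : Env A →+* Env A where
  toFun := envStarAdd A
  map_zero' := map_zero _
  map_add' := map_add _
  map_one' := by
    change envStarAdd A ((1 : A) ⊗ₜ[ℂ] (1 : Aᵐᵒᵖ)) = _
    simp [envStarAdd, Algebra.TensorProduct.one_def]
  map_mul' e f := by
    induction e using TensorProduct.induction_on with
    | zero => simp
    | add e e' h h' => rw [add_mul, map_add, map_add, add_mul, h, h']
    | tmul a b =>
      induction f using TensorProduct.induction_on with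
      | zero => simp
      | add e e' h h' => rw [mul_add, map_add, map_add, mul_add, h, h']
      | tmul a' b' => simp [envStarAdd]

variable {A}

theorem envStar_tmul (a : A) (b : Aᵐᵒᵖ) :
    envStar A (a ⊗ₜ[ℂ] b) = star b.unop ⊗ₜ[ℂ] MulOpposite.op (star a) := rfl

/-- `envStar` exchanges the two terms of `1 ⊗ a - a ⊗ 1`, hence the minus sign in the involution of
one-forms. -/
theorem neg_envStar_duEnv (a : A) : -envStar A (duEnv A a) = duEnv A (star a) := by
  rw [duEnv_apply, duEnv_apply, map_sub, envStar_tmul, envStar_tmul]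
  simp

theorem neg_envStar_mem {ω : Env A} (h : ω ∈ uForms A) : -envStar A ω ∈ uForms A := by
  induction h using Submodule.span_induction with
  | mem ω hω =>
    obtain ⟨a, rfl⟩ := hω
    rw [neg_envStar_duEnv]
    exact Submodule.subset_span ⟨_, rfl⟩
  | zero => simp
  | add ω η _ _ h1 h2 => rw [map_add, neg_add]; exact add_mem h1 h2
  | smul e ω _ h =>
    have h2 : envStar A e * -envStar A ω ∈ uForms A := Submodule.smul_mem _ _ h
    have h3 : envStar A e * -envStar A ω = -(envStar A e * envStar A ω) := env_mul_neg _ _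
    rw [smul_eq_mul, map_mul]
    exact h3 ▸ h2

variable (A)

/-- The involution of the universal one-forms. -/
def uStar : UForms A →ₛₗ[envStar A] UForms A where
  toFun ω := (⟨-envStar A (ω : uForms A).1, neg_envStar_mem (ω : uForms A).2⟩ : uForms A)
  map_add' ω η := Subtype.ext (by
    change -envStar A ((ω : uForms A).1 + (η : uForms A).1) = _
    rw [map_add, neg_add]; rfl)
  map_smul' e ω := Subtype.ext (by
    change -envStar A (e * (ω : uForms A).1) = envStar A e * -envStar A (ω : uForms A).1
    rw [map_mul]
    exact (env_mul_neg _ _).symm)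

variable {A}

theorem uStar_du (a : A) : uStar A (du A a) = du A (star a) :=
  Subtype.ext (neg_envStar_duEnv a)

theorem map_left_of_semilinear {M M' : Type*} [AddCommGroup M] [Module (Env A) M]
    [AddCommGroup M'] [Module (Env A) M'] (f : Bim A M →ₛₗ[envStar A] Bim A M') (a : A)
    (m : Bim A M) : f (a • m) = MulOpposite.op (star a) • f m := by
  rw [left_smul, f.map_smulₛₗ, envStar_tmul, right_smul]
  simp

theorem map_right_of_semilinear {M M' : Type*} [AddCommGroup M] [Module (Env A) M]
    [AddCommGroup M'] [Module (Env A) M'] (f : Bim A M →ₛₗ[envStar A] Bim A M') (a : A)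
    (m : Bim A M) : f (MulOpposite.op a • m) = star a • f m := by
  rw [right_smul, f.map_smulₛₗ, envStar_tmul, left_smul]
  simp

/-- The quotient of the universal calculus by relations stable under the involution is a
`*`-calculus. -/
theorem quotCalculus_isStarCalculus (S : Set (UForms A))
    (hS : ∀ ω ∈ S, qmk S (uStar A ω) = 0) :
    (quotCalculus S).IsStarCalculus ∧ ∃! s, (quotCalculus S).IsFormStar s := by
  -- By semilinearity over `envStar` the preimage is again a sub-bimodule, so checking the
  -- generators suffices.
  have h : Submodule.span (Env A) S ≤ (Submodule.span (Env A) S).comap (uStar A) :=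
    Submodule.span_le.2 fun ω hω => (Submodule.Quotient.mk_eq_zero (Submodule.span (Env A) S)).1 (hS ω hω)
  let s : QForms S →ₛₗ[envStar A] QForms S := Submodule.mapQ _ _ (uStar A) h
  refine (quotCalculus S).isStarCalculus_of_map s.toAddMonoidHom
    (fun a ω => map_left_of_semilinear s a ω) fun a => ?_
  change qmk S (uStar A (du A a)) = qmk S (du A (star a))
  rw [uStar_du]

end UniversalStar

/-! ### The calculi on the quantum sphere -/

section Main

theorem Sphere.induction {N : ℕ} {q : ℝ} {p : Sphere N q → Prop} (scalar : ∀ r : ℂ, p (r • 1))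
    (gen : ∀ i, p (x q i)) (mul : ∀ a b, p a → p b → p (a * b))
    (add : ∀ a b, p a → p b → p (a + b)) (a : Sphere N q) : p a := by
  obtain ⟨a, rfl⟩ := RingQuot.mkAlgHom_surjective ℂ (Rel N q) a
  change p (mk N q a)
  induction a using FreeAlgebra.induction with
  | grade0 r => rw [AlgHom.commutes, Algebra.algebraMap_eq_smul_one]; exact scalar r
  | grade1 i => exact gen i
  | mul a b ha hb => rw [map_mul]; exact mul _ _ ha hb
  | add a b ha hb => rw [map_add]; exact add _ _ ha hb

variable {N : ℕ} {q : ℝ} [hq : Fact (0 < q)]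

theorem calculus_isStarCalculus (hN : 2 ≤ N) (hq1 : q ≠ 1) (ε : ℤˣ) :
    (calculus N q ε).IsStarCalculus ∧ ∃! s, (calculus N q ε).IsFormStar s := by
  refine quotCalculus_isStarCalculus _ ?_
  rintro _ ⟨⟨i, j⟩, rfl⟩
  let s : UForms (Sphere N q) →ₛₗ[envStar (Sphere N q)] Forms N q ε :=
    (qmk (relations N q ε)).comp (uStar (Sphere N q))
  have hl := fun a ω => map_left_of_semilinear s a ω
  have hd : ∀ a, s (du (Sphere N q) a) = (calculus N q ε).d (star a) := fun a =>
    congrArg (qmk (relations N q ε)) (uStar_du a)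
  change s (_ - _) = 0
  -- The source is the universal calculus and the target is `Γ_ε`, where the dual relations hold.
  -- Both sides of a defining relation are thus sent to `x_j^* d(x_i^*)`.
  have key := map_prescribed hN hq1 (calculus_hasStructure N q ε) s.toAddMonoidHom
    (map_conj_smul_of_map_left hl) hl (du (Sphere N q)) (fun l => hd _) i j
  have key' : s (prescribed ε (du (Sphere N q)) i j) = _ := key
  rw [map_sub, key', map_right_of_semilinear, hd, sub_self]

variable {Γ : Type*} [AddCommGroup Γ] [Module ℂ Γ]
  [Module (Sphere N q) Γ] [Module (Sphere N q)ᵐᵒᵖ Γ]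
  [SMulCommClass (Sphere N q) (Sphere N q)ᵐᵒᵖ Γ] [IsScalarTower ℂ (Sphere N q) Γ]
  [IsScalarTower ℂ (Sphere N q)ᵐᵒᵖ Γ]

/-- Freeness makes a left-reversing map with prescribed values on the `dx_i` well defined.
Compatibility with right multiplication holds for generators by the dual relations and extends to
products; the Leibniz rule then gives `(da)^* = d(a^*)` for all `a`. -/
theorem isStarCalculus_of_isFree (hN : 2 ≤ N) (hq1 : q ≠ 1) {ε : ℤˣ}
    {D : Calculus (Sphere N q) Γ} (hF : IsFree D) (hD : HasStructure ε D) :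
    D.IsStarCalculus ∧ ∃! s, D.IsFormStar s := by
  let b : Module.Basis (Fin N) (Sphere N q) Γ := Module.Basis.mk hF.1 hF.2.ge
  have hb : ∀ i, b i = D.d (x q i) := fun i => Module.Basis.mk_apply _ _ i
  let s : Γ →+ Γ :=
    { toFun := fun ω => ∑ i, MulOpposite.op (star (b.repr ω i)) • D.d (star (x q i))
      map_zero' := by simp
      map_add' := fun ω η => by simp [add_smul, Finset.sum_add_distrib] }
  have hl : ∀ (a : Sphere N q) (ω : Γ), s (a • ω) = MulOpposite.op (star a) • s ω := by
    intro a ω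
    simp [s, mul_smul, Finset.smul_sum]
  have hx : ∀ i, s (D.d (x q i)) = D.d (star (x q i)) := by
    intro i
    change ∑ k, MulOpposite.op (star (b.repr (D.d (x q i)) k)) • D.d (star (x q k)) = _
    rw [← hb, b.repr_self, Finset.sum_eq_single i]
    · simp
    · intro k _ hk; simp [Ne.symm hk]
    · simp
  have hs := map_conj_smul_of_map_left hl
  have hrx : ∀ (j : Fin N) (ω : Γ),
      s (MulOpposite.op (x q j) • ω) = star (x q j) • s ω := by
    intro j ω
    rw [← b.sum_repr ω]
    simp only [Finset.smul_sum, map_sum]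
    refine Finset.sum_congr rfl fun i _ => ?_
    rw [hb, ← smul_comm, hl, hl, hx, hD i j,
      map_prescribed hN hq1 hD s hs hl D.d hx i j]
    exact (smul_comm _ _ _).symm
  have hr : ∀ (a : Sphere N q) (ω : Γ), s (MulOpposite.op a • ω) = star a • s ω := by
    intro a
    refine Sphere.induction (p := fun a => ∀ ω, s (MulOpposite.op a • ω) = star a • s ω)
      ?_ hrx ?_ ?_ a
    · intro r ω
      rw [MulOpposite.op_smul, MulOpposite.op_one, smul_assoc, one_smul, hs, star_smul, star_one,
        smul_assoc, one_smul]
      rfl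
    · intro a a' h h' ω
      rw [MulOpposite.op_mul, mul_smul, h', h, star_mul, mul_smul]
    · intro a a' h h' ω
      rw [MulOpposite.op_add, add_smul, map_add, h, h', star_add, add_smul]
  refine D.isStarCalculus_of_map s hl fun a => ?_
  refine Sphere.induction (p := fun a => s (D.d a) = D.d (star a)) ?_ hx ?_ ?_ a
  · intro r
    rw [star_smul, star_one, D.d.map_smul, D.d.map_smul, d_one, smul_zero, smul_zero, map_zero]
  · intro a a' h h'
    rw [D.leibniz, map_add, hr, hl, h, h', star_mul, D.leibniz, add_comm]
  · intro a a' h h'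
    rw [map_add, map_add, h, h', star_add, map_add]

end Main

end QSphere

end

theorem mainTheorem9 (N : ℕ) (hN : 3 ≤ N) (q : ℝ) [Fact (0 < q)] (hq1 : q ≠ 1) (ε : ℤˣ) :
    ((QSphere.calculus N q ε).IsStarCalculus ∧ ∃! s, (QSphere.calculus N q ε).IsFormStar s) ∧
    (∀ (Γ : Type*) [AddCommGroup Γ] [Module ℂ Γ] [Module (QSphere.Sphere N q) Γ]
      [Module (QSphere.Sphere N q)ᵐᵒᵖ Γ]
      [SMulCommClass (QSphere.Sphere N q) (QSphere.Sphere N q)ᵐᵒᵖ Γ]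
      [IsScalarTower ℂ (QSphere.Sphere N q) Γ] [IsScalarTower ℂ (QSphere.Sphere N q)ᵐᵒᵖ Γ]
      (D : QSphere.Calculus (QSphere.Sphere N q) Γ),
      QSphere.IsFree D → QSphere.HasStructure ε D →
        D.IsStarCalculus ∧ ∃! s, D.IsFormStar s) := by
  exact ⟨QSphere.calculus_isStarCalculus (by omega) hq1 ε,
    fun _ _ _ _ _ _ _ _ _ hF hD => QSphere.isStarCalculus_of_isFree (by omega) hq1 hF hD⟩
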